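/- Let $\mathcal S$ and $\mathcal A$ be finite non-empty sets of states and actions and let $\tau\ge 1$ be an integer. An MDP $M$ consists of reward distributions $R^M_a(s)$ on $[0,1]$ with means $\overline R^M_a(s)$, transition distributions $P^M_a(\cdot\mid s)$ on $\mathcal S$ (for $s\in\mathcal S$, $a\in\mathcal A$), and an initial state distribution $\rho^M$ on $\mathcal S$; the space of MDPs carries the $\sigma$-algebra generated by the probabilities that these distributions give to measurable sets. A policy is a map $\mu:\mathcal S\times\{1,\dots,\tau\}\to\mathcal A$, and its value functions are $$V^M_{\mu,i}(s)=\mathbb E_{M,\mu}\Big[\sum_{j=i}^{\tau}\overline R^M_{a_j}(s_j)\,\Big|\,s_i=s\Big],\qquad a_j=\mu(s_j,j),\quad s_{j+1}\sim P^M_{a_j}(\cdot\mid s_j).$$ A policy $\mu$ is optimal for $M$ if $V^M_{\mu,i}(s)=\max_{\mu'}V^M_{\mu',i}(s)$ for all $s$ and $i$. Fix a measurable map $M\mapsto\mu^M$ such that $\mu^M$ is optimal for $M$, for every MDP $M$. Let $f$ be any probability distribution on the space of MDPs (the prior) and let the true MDP $M^*$ be a random MDP with distribution $f$. Posterior sampling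 (PSRL) interacts with $M^*$ in episodes $k=1,2,\dots$, episode $k$ starting at time $t_k=(k-1)\tau+1$ and lasting $\tau$ steps, as follows. Let $H_t=(s_1,a_1,r_1,\dots,s_{t-1},a_{t-1},r_{t-1})$ be the history before time $t$. At the start of episode $k$ an MDP $M_k$ is sampled from the posterior distribution of $M^*$ given $H_{t_k}$ (conditionally on $H_{t_k}$, independently of $M^*$ and of $M_1,\dots,M_{k-1}$), and the policy $\mu_k=\mu^{M_k}$ is followed during the episode: given the past (including $M^*$ and $M_1,\dots,M_k$), $s_{t_k}\sim\rho^{M^*}$; at step $j=1,\dots,\tau$, i.e. at time $t=t_k+j-1$, the action is $a_t=\mu_k(s_t,j)$, the reward is $r_t\sim R^{M^*}_{a_t}(s_t)$, and, if $j<\tau$, the next state is $s_{t+1}\sim P^{M^*}_{a_t}(\cdot\mid s_t)$. For $T\in\mathbb N$ the regret is $$\mathrm{Regret}(T)=\sum_{k=1}^{\lceil T/\tau\rceil}\Delta_k,\qquad \Delta_k=\sum_{s\in\mathcal S}\rho^{M^*}(s)\big(V^{M^*}_{\mu^{M^*},1}(s)-V^{M^*}_{\mu_k,1}(s)\big).$$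 Then for every $\alpha>\tfrac12$, as $T\to\infty$, $\mathrm{Regret}(T)/T^{\alpha}\to 0$ in probability. -/

import Mathlib

open MeasureTheory ProbabilityTheory Filter Topology

namespace PSRL

/-- A finite-horizon MDP on the finite state space `S` and the action space `A` (the horizon `τ` is
a parameter of the notions below): for each state `s` and action `a` a reward distribution on
`[0,1]` and a transition distribution on `S`, and an initial state distribution. -/
structure MDP (S A : Type*) [MeasurableSpace S] where
  /-- `reward s a` is the distribution of the reward when action `a` is selected in state `s`. -/
  reward : S → A → ProbabilityMeasure unitInterval
  /-- `trans s a` is the distribution of the next state. -/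
  trans : S → A → ProbabilityMeasure S
  /-- the initial state distribution `ρ`. -/
  init : ProbabilityMeasure S

/-- The σ-algebra on the space of MDPs: the smallest one for which the reward, transition and
initial distributions are measurable as measure-valued maps, that is, for which the probability
that each of them gives to each measurable set is a measurable function of the MDP. -/
instance MDP.instMeasurableSpace {S A : Type*} [MeasurableSpace S] : MeasurableSpace (MDP S A) :=
  MeasurableSpace.comap
    (fun M : MDP S A =>
      ((fun (s : S) (a : A) => (M.reward s a : Measure unitInterval)),
        (fun (s : S) (a : A) => (M.trans s a : Measure S)),
        (M.init : Measure S)))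
    inferInstance

/-- A deterministic policy: at each of the `τ` steps of an episode (numbered `0, …, τ - 1`) and in
each state, an action. -/
abbrev Policy (S A : Type*) (τ : ℕ) := Fin τ → S → A

/-- The expected reward when action `a` is selected in state `s`. -/
noncomputable def MDP.meanReward {S A : Type*} [MeasurableSpace S] (M : MDP S A) (s : S) (a : A) :
    ℝ :=
  ∫ x : unitInterval, (x : ℝ) ∂(M.reward s a : Measure unitInterval)

open Classical in
/-- The probability, in the MDP `M` under the policy `μ` and started in state `s` at step `i`, that
the states at the steps `i, i + 1, …, τ - 1` are `x 0, x 1, …, x (τ - i - 1)`. -/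
noncomputable def MDP.pathProb {S A : Type*} [MeasurableSpace S] {τ : ℕ} (M : MDP S A)
    (μ : Policy S A τ) (i : Fin τ) (s : S) (x : Fin (τ - i) → S) : ℝ :=
  (if x ⟨0, by omega⟩ = s then 1 else 0) *
    ∏ j : Fin (τ - i - 1),
      (M.trans (x ⟨j, by omega⟩) (μ ⟨i + j, by omega⟩ (x ⟨j, by omega⟩)) : Measure S).real
        {x ⟨j + 1, by omega⟩}

/-- The value function: the expectation, over the trajectory of states at the steps
`i, …, τ - 1` started in `s` at step `i`, of the sum of the mean rewards along the trajectory. -/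
noncomputable def MDP.value {S A : Type*} [Fintype S] [MeasurableSpace S] {τ : ℕ} (M : MDP S A)
    (μ : Policy S A τ) (i : Fin τ) (s : S) : ℝ :=
  ∑ x : Fin (τ - i) → S, M.pathProb μ i s x *
    ∑ j : Fin (τ - i), M.meanReward (x j) (μ ⟨i + j, by omega⟩ (x j))

/-- `μ` is optimal for `M`: at each step and in each state its value is the maximum of the values
of all policies. -/
def MDP.IsOptimal {S A : Type*} [Fintype S] [MeasurableSpace S] {τ : ℕ} (M : MDP S A)
    (μ : Policy S A τ) : Prop :=
  ∀ (i : Fin τ) (s : S),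
    IsGreatest (Set.range fun μ' : Policy S A τ => M.value μ' i s) (M.value μ i s)

/-- The history of observations (states, actions, rewards) made before time `t`. Times are numbered
`0, 1, 2, …`. -/
def history {Ω S A : Type*} (s : ℕ → Ω → S) (a : ℕ → Ω → A) (r : ℕ → Ω → unitInterval) (t : ℕ)
    (ω : Ω) : Fin t → S × A × unitInterval :=
  fun u => (s u ω, a u ω, r u ω)

/-- The σ-algebra generated by the history before time `t`. -/
@[reducible] def historySigma {Ω S A : Type*} [MeasurableSpace S] [MeasurableSpace A]
    (s : ℕ → Ω → S) (a : ℕ → Ω → A) (r : ℕ → Ω → unitInterval) (t : ℕ) : MeasurableSpace Ω :=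
  MeasurableSpace.comap (history s a r t) inferInstance

/-- The σ-algebra generated by the true MDP, the MDPs sampled in the first `k` episodes and the
history before time `t`. -/
@[reducible] def pastSigma {Ω S A : Type*} [MeasurableSpace S] [MeasurableSpace A]
    (Mstar : Ω → MDP S A) (Msamp : ℕ → Ω → MDP S A)
    (s : ℕ → Ω → S) (a : ℕ → Ω → A) (r : ℕ → Ω → unitInterval) (k t : ℕ) : MeasurableSpace Ω :=
  MeasurableSpace.comap
    (fun ω => (Mstar ω, (fun e : Fin k => Msamp e ω), history s a r t ω)) inferInstance

/-- The random variables `Mstar` (true MDP), `Msamp k` (MDP sampled at the start of episode `k`),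
`s t`, `a t`, `r t` (state, action and reward at time `t`) describe the interaction of posterior
sampling, with prior `f` and with the policy `opt M` chosen for the MDP `M`, with an MDP whose
distribution is `f`. Episodes are numbered `0, 1, 2, …`, and episode `k` consists of the
times `k * τ + j` for `j < τ`. -/
structure IsPSRL {Ω S A : Type*} [MeasurableSpace Ω] [MeasurableSpace S] [MeasurableSpace A]
    (P : Measure Ω) (τ : ℕ) (f : Measure (MDP S A)) (opt : MDP S A → Policy S A τ)
    (Mstar : Ω → MDP S A) (Msamp : ℕ → Ω → MDP S A)
    (s : ℕ → Ω → S) (a : ℕ → Ω → A) (r : ℕ → Ω → unitInterval) : Prop where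
  measurable_Mstar : Measurable Mstar
  measurable_Msamp : ∀ k, Measurable (Msamp k)
  measurable_s : ∀ t, Measurable (s t)
  measurable_a : ∀ t, Measurable (a t)
  measurable_r : ∀ t, Measurable (r t)
  /-- The prior is the distribution of the true MDP. -/
  law_Mstar : P.map Mstar = f
  /-- At the start of episode `k`, given everything that happened before (and the true MDP), the
  sampled MDP is drawn from the posterior distribution of the true MDP given the history. -/
  sample : ∀ (k : ℕ) (B : Set (MDP S A)), MeasurableSet B →
    P⟦Msamp k ⁻¹' B | pastSigma Mstar Msamp s a r k (k * τ)⟧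
      =ᵐ[P] P⟦Mstar ⁻¹' B | historySigma s a r (k * τ)⟧
  /-- Each episode starts in a state drawn from the initial distribution of the true MDP. -/
  initial : ∀ (k : ℕ) (x : S),
    P⟦s (k * τ) ⁻¹' {x} | pastSigma Mstar Msamp s a r (k + 1) (k * τ)⟧
      =ᵐ[P] fun ω => ((Mstar ω).init : Measure S).real {x}
  /-- In episode `k` the actions are those of the policy chosen for the sampled MDP. -/
  action : ∀ (k : ℕ) (j : Fin τ),
    ∀ᵐ ω ∂P, a (k * τ + j) ω = opt (Msamp k ω) j (s (k * τ + j) ω)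
  /-- The rewards are drawn from the reward distributions of the true MDP. -/
  reward : ∀ (k : ℕ) (j : Fin τ) (B : Set unitInterval), MeasurableSet B →
    P⟦r (k * τ + j) ⁻¹' B | pastSigma Mstar Msamp s a r (k + 1) (k * τ + j) ⊔
        MeasurableSpace.comap (fun ω => (s (k * τ + j) ω, a (k * τ + j) ω)) inferInstance⟧
      =ᵐ[P] fun ω =>
        ((Mstar ω).reward (s (k * τ + j) ω) (a (k * τ + j) ω) : Measure unitInterval).real B
  /-- Within an episode the transitions follow the true MDP. -/
  transition : ∀ (k j : ℕ), j + 1 < τ → ∀ x : S,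
    P⟦s (k * τ + j + 1) ⁻¹' {x} | pastSigma Mstar Msamp s a r (k + 1) (k * τ + j + 1)⟧
      =ᵐ[P] fun ω =>
        ((Mstar ω).trans (s (k * τ + j) ω) (a (k * τ + j) ω) : Measure S).real {x}

/-- The regret over an episode in which the policy is `opt M'`, with respect to the MDP `M`. -/
noncomputable def episodeRegret {S A : Type*} [Fintype S] [MeasurableSpace S] {τ : ℕ} [NeZero τ]
    (opt : MDP S A → Policy S A τ) (M M' : MDP S A) : ℝ :=
  ∑ x : S, (M.init : Measure S).real {x} * (M.value (opt M) 0 x - M.value (opt M') 0 x)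

/-- The regret up to time `T`: the sum of the regrets over the first `⌈T / τ⌉` episodes. -/
noncomputable def regret {Ω S A : Type*} [Fintype S] [MeasurableSpace S] {τ : ℕ} [NeZero τ]
    (opt : MDP S A → Policy S A τ) (Mstar : Ω → MDP S A) (Msamp : ℕ → Ω → MDP S A)
    (T : ℕ) (ω : Ω) : ℝ :=
  ∑ k ∈ Finset.range ⌈(T : ℝ) / (τ : ℝ)⌉₊, episodeRegret opt (Mstar ω) (Msamp k ω)

end PSRL

namespace PSRL

section PathSums

variable {S : Type*} [Fintype S]

open Classical in
/-- The weight of a path `x 0, …, x n` from `s` at step `i`, for transition kernels `q`. -/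
noncomputable def pathWeight (q : ℕ → S → S → ℝ) (n i : ℕ) (s : S) (x : Fin (n + 1) → S) : ℝ :=
  (if x 0 = s then 1 else 0) * ∏ j : Fin n, q (i + j) (x j.castSucc) (x j.succ)

theorem sum_pathWeight_succ (q : ℕ → S → S → ℝ) (n i : ℕ) (s : S)
    (F : (Fin (n + 2) → S) → ℝ) :
    ∑ x, pathWeight q (n + 1) i s x * F x =
      ∑ y, q i s y * ∑ x, pathWeight q n (i + 1) y x * F (Fin.cons s x : Fin (n + 2) → S) := by
  classical
  have h1 : ∑ x, pathWeight q (n + 1) i s x * F x =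
      ∑ x : Fin (n + 1) → S, pathWeight q (n + 1) i s (Fin.cons s x : Fin (n + 2) → S) *
        F (Fin.cons s x : Fin (n + 2) → S) := by
    rw [← (Fin.consEquiv fun _ : Fin (n + 2) => S).sum_comp, Fintype.sum_prod_type]
    rw [Finset.sum_eq_single s]
    · rfl
    · intro b _ hb
      refine Finset.sum_eq_zero fun x _ => ?_
      simp [pathWeight, Fin.consEquiv, hb]
    · simp
  rw [h1]
  simp_rw [Finset.mul_sum]
  rw [Finset.sum_comm]
  refine Finset.sum_congr rfl fun x _ => ?_
  rw [Finset.sum_eq_single (x 0)]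
  · have h2 : ∀ j : Fin n, i + 1 + (j : ℕ) = i + ((j : ℕ) + 1) := fun j => by omega
    simp [pathWeight, Fin.prod_univ_succ, h2, mul_assoc]
  · intro b _ hb
    simp [pathWeight, Ne.symm hb]
  · simp

theorem sum_pathWeight (q : ℕ → S → S → ℝ) (hq : ∀ i s, ∑ y, q i s y = 1) (n i : ℕ) (s : S) :
    ∑ x, pathWeight q n i s x = 1 := by
  classical
  induction n generalizing i s with
  | zero =>
    rw [← (Equiv.funUnique (Fin 1) S).symm.sum_comp]
    simp [pathWeight]
  | succ n ih =>
    have h := sum_pathWeight_succ q n i s fun _ => 1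
    simp only [mul_one] at h
    simp [h, ih, hq]

/-- The expected sum of the rewards `R` along a path of `n + 1` states from `s` at step `i`. -/
noncomputable def pathValue (R : ℕ → S → ℝ) (q : ℕ → S → S → ℝ) (n i : ℕ) (s : S) : ℝ :=
  ∑ x, pathWeight q n i s x * ∑ j : Fin (n + 1), R (i + j) (x j)

theorem pathValue_zero (R : ℕ → S → ℝ) (q : ℕ → S → S → ℝ) (i : ℕ) (s : S) :
    pathValue R q 0 i s = R i s := by
  classical
  rw [pathValue, ← (Equiv.funUnique (Fin 1) S).symm.sum_comp]
  simp [pathWeight]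

theorem pathValue_succ (R : ℕ → S → ℝ) (q : ℕ → S → S → ℝ) (hq : ∀ i s, ∑ y, q i s y = 1)
    (n i : ℕ) (s : S) :
    pathValue R q (n + 1) i s = R i s + ∑ y, q i s y * pathValue R q n (i + 1) y := by
  rw [pathValue, sum_pathWeight_succ]
  have h2 : ∀ j : Fin (n + 1), i + ((j : ℕ) + 1) = i + 1 + (j : ℕ) := fun j => by omega
  have h : ∀ y, ∑ x, pathWeight q n (i + 1) y x *
      ∑ j : Fin (n + 2), R (i + j) ((Fin.cons s x : Fin (n + 2) → S) j) =
      R i s + pathValue R q n (i + 1) y := by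
    intro y
    simp only [Fin.sum_univ_succ (n := n + 1), Fin.cons_zero, Fin.cons_succ, Fin.val_zero,
      add_zero, Fin.val_succ, h2, mul_add, Finset.sum_add_distrib, ← Finset.sum_mul,
      sum_pathWeight q hq, one_mul, pathValue]
  simp only [h, mul_add, Finset.sum_add_distrib, ← Finset.sum_mul, hq, one_mul]

end PathSums

section Value

variable {S A : Type*} [MeasurableSpace S] {τ : ℕ}

/-- The probability of the transition to `y` when action `a` is selected in state `x`. -/
noncomputable def MDP.transProb (M : MDP S A) (x : S) (a : A) (y : S) : ℝ :=
  (M.trans x a : Measure S).real {y}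

/-- The probability that `x` is the initial state. -/
noncomputable def MDP.initProb (M : MDP S A) (x : S) : ℝ :=
  (M.init : Measure S).real {x}

theorem MDP.transProb_nonneg (M : MDP S A) (x : S) (a : A) (y : S) : 0 ≤ M.transProb x a y :=
  measureReal_nonneg

theorem MDP.transProb_le_one (M : MDP S A) (x : S) (a : A) (y : S) : M.transProb x a y ≤ 1 :=
  measureReal_le_one

theorem MDP.initProb_nonneg (M : MDP S A) (x : S) : 0 ≤ M.initProb x :=
  measureReal_nonneg

theorem MDP.initProb_le_one (M : MDP S A) (x : S) : M.initProb x ≤ 1 :=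
  measureReal_le_one

theorem MDP.meanReward_nonneg (M : MDP S A) (x : S) (a : A) : 0 ≤ M.meanReward x a :=
  integral_nonneg fun u => u.2.1

theorem MDP.meanReward_le_one (M : MDP S A) (x : S) (a : A) : M.meanReward x a ≤ 1 := by
  have h := integral_mono_of_nonneg (μ := (M.reward x a : Measure unitInterval))
    (f := fun u => (u : ℝ)) (g := fun _ => 1) (ae_of_all _ fun u => u.2.1)
    (integrable_const _) (ae_of_all _ fun u => u.2.2)
  simpa [MDP.meanReward] using h

variable [Fintype S]

/-- A policy extended to all steps. -/
noncomputable def Policy.extend [Nonempty A] (μ : Policy S A τ) (i : ℕ) (x : S) : A :=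
  if h : i < τ then μ ⟨i, h⟩ x else Classical.arbitrary A

theorem MDP.value_eq_pathValue [Nonempty A] (M : MDP S A) (μ : Policy S A τ) (i : Fin τ) (n : ℕ)
    (hn : τ - i = n + 1) (x : S) :
    M.value μ i x = pathValue (fun j y => M.meanReward y (Policy.extend μ j y))
      (fun j y => M.transProb y (Policy.extend μ j y)) n i x := by
  have key : ∀ (m : ℕ) (hm : τ - i = m) (hpos : 0 < m), M.value μ i x =
      ∑ z : Fin m → S, ((@ite ℝ (z ⟨0, hpos⟩ = x) (Classical.propDecidable _) 1 0) *
        ∏ j : Fin (m - 1), M.transProb (z ⟨j, by omega⟩)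
          (Policy.extend μ (i + j) (z ⟨j, by omega⟩)) (z ⟨j + 1, by omega⟩)) *
        ∑ j : Fin m, M.meanReward (z j) (Policy.extend μ (i + j) (z j)) := by
    intro m hm hpos
    subst hm
    unfold MDP.value MDP.pathProb
    refine Finset.sum_congr rfl fun z _ => ?_
    congr 1
    · congr 1
      refine Finset.prod_congr rfl fun j _ => ?_
      rw [Policy.extend, dif_pos (by omega)]
      rfl
    · refine Finset.sum_congr rfl fun j _ => ?_
      rw [Policy.extend, dif_pos (by omega)]
  rw [key (n + 1) hn (Nat.succ_pos n)]
  rfl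

theorem MDP.value_of_add_one_eq [Nonempty A] (M : MDP S A) (μ : Policy S A τ) (i : Fin τ)
    (h : i + 1 = τ) (x : S) : M.value μ i x = M.meanReward x (μ i x) := by
  rw [M.value_eq_pathValue μ i 0 (by omega) x, pathValue_zero]
  rw [Policy.extend, dif_pos i.2]

theorem episodeRegret_nonneg [NeZero τ] (opt : MDP S A → Policy S A τ)
    (hopt : ∀ M : MDP S A, M.IsOptimal (opt M)) (M M' : MDP S A) :
    0 ≤ episodeRegret opt M M' :=
  Finset.sum_nonneg fun x _ => mul_nonneg measureReal_nonneg
    (sub_nonneg.2 ((hopt M 0 x).2 ⟨opt M', rfl⟩))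

variable [DiscreteMeasurableSpace S]

theorem MDP.sum_transProb (M : MDP S A) (x : S) (a : A) : ∑ y, M.transProb x a y = 1 := by
  simp only [MDP.transProb, sum_measureReal_singleton, Finset.coe_univ, probReal_univ]

theorem MDP.value_of_add_one_lt [Nonempty A] (M : MDP S A) (μ : Policy S A τ) (i : Fin τ)
    (h : i + 1 < τ) (x : S) :
    M.value μ i x = M.meanReward x (μ i x) +
      ∑ y, M.transProb x (μ i x) y * M.value μ ⟨i + 1, h⟩ y := by
  obtain ⟨n, hn⟩ : ∃ n, τ - i = (n + 1) + 1 := ⟨τ - i - 2, by omega⟩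
  rw [M.value_eq_pathValue μ i (n + 1) hn x,
    pathValue_succ _ _ (fun j y => M.sum_transProb y _)]
  have hx : Policy.extend μ i x = μ i x := by
    rw [Policy.extend, dif_pos i.2]
  simp only [hx]
  congr 1
  refine Finset.sum_congr rfl fun y _ => ?_
  rw [M.value_eq_pathValue μ ⟨i + 1, h⟩ n (by simp only; omega) y]

theorem MDP.value_mem_Icc [Nonempty A] (M : MDP S A) (μ : Policy S A τ) (i : Fin τ) (x : S) :
    M.value μ i x ∈ Set.Icc (0 : ℝ) (τ - i : ℕ) := by
  obtain ⟨n, hn⟩ : ∃ n, τ - i = n + 1 := ⟨τ - i - 1, by omega⟩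
  induction n generalizing i x with
  | zero =>
    rw [M.value_of_add_one_eq μ i (by omega), hn]
    exact ⟨M.meanReward_nonneg _ _, by simpa using M.meanReward_le_one _ _⟩
  | succ n ih =>
    have h : (i : ℕ) + 1 < τ := by omega
    have hi : ∀ y, M.value μ ⟨i + 1, h⟩ y ∈ Set.Icc (0 : ℝ) (n + 1 : ℕ) := fun y => by
      have h2 : τ - ((⟨i + 1, h⟩ : Fin τ) : ℕ) = n + 1 := by simp only; omega
      have := ih ⟨i + 1, h⟩ y h2
      rwa [h2] at this
    rw [M.value_of_add_one_lt μ i h, hn]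
    have h0 : 0 ≤ ∑ y, M.transProb x (μ i x) y * M.value μ ⟨i + 1, h⟩ y :=
      Finset.sum_nonneg fun y _ => mul_nonneg (M.transProb_nonneg _ _ _) (hi y).1
    have h1 : ∑ y, M.transProb x (μ i x) y * M.value μ ⟨i + 1, h⟩ y ≤ (n + 1 : ℕ) := by
      calc _ ≤ ∑ y, M.transProb x (μ i x) y * ((n + 1 : ℕ) : ℝ) :=
            Finset.sum_le_sum fun y _ =>
              mul_le_mul_of_nonneg_left (hi y).2 (M.transProb_nonneg _ _ _)
        _ = _ := by rw [← Finset.sum_mul, M.sum_transProb, one_mul]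
    constructor
    · exact add_nonneg (M.meanReward_nonneg _ _) h0
    · have := M.meanReward_le_one x (μ i x)
      push_cast at h1 ⊢
      linarith

theorem MDP.value_nonneg [Nonempty A] (M : MDP S A) (μ : Policy S A τ) (i : Fin τ) (x : S) :
    0 ≤ M.value μ i x := (M.value_mem_Icc μ i x).1

theorem MDP.value_le [Nonempty A] (M : MDP S A) (μ : Policy S A τ) (i : Fin τ) (x : S) :
    M.value μ i x ≤ τ :=
  (M.value_mem_Icc μ i x).2.trans (by exact_mod_cast Nat.sub_le _ _)

end Value

section Measurability

variable {S A : Type*} [MeasurableSpace S]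

theorem MDP.measurable_toMeasures : Measurable fun M : MDP S A =>
    ((fun (s : S) (a : A) => (M.reward s a : Measure unitInterval)),
      (fun (s : S) (a : A) => (M.trans s a : Measure S)), (M.init : Measure S)) :=
  comap_measurable _

theorem MDP.measurable_reward (x : S) (a : A) :
    Measurable fun M : MDP S A => (M.reward x a : Measure unitInterval) := by
  have h := MDP.measurable_toMeasures (S := S) (A := A)
  exact measurable_pi_iff.1 (measurable_pi_iff.1 h.fst x) a

theorem MDP.measurable_trans (x : S) (a : A) :
    Measurable fun M : MDP S A => (M.trans x a : Measure S) := by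
  have h := MDP.measurable_toMeasures (S := S) (A := A)
  exact measurable_pi_iff.1 (measurable_pi_iff.1 h.snd.fst x) a

theorem MDP.measurable_init : Measurable fun M : MDP S A => (M.init : Measure S) := by
  have h := MDP.measurable_toMeasures (S := S) (A := A)
  exact h.snd.snd

theorem MDP.meanReward_eq_lintegral (M : MDP S A) (x : S) (a : A) :
    M.meanReward x a =
      (∫⁻ u : unitInterval, ENNReal.ofReal u ∂(M.reward x a : Measure unitInterval)).toReal :=
  integral_eq_lintegral_of_nonneg_ae (ae_of_all _ fun u => u.2.1)
    measurable_subtype_coe.aestronglyMeasurable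

@[fun_prop]
theorem MDP.measurable_meanReward (x : S) (a : A) :
    Measurable fun M : MDP S A => M.meanReward x a := by
  simp_rw [MDP.meanReward_eq_lintegral]
  exact ((Measure.measurable_lintegral
    (ENNReal.measurable_ofReal.comp measurable_subtype_coe)).comp
      (MDP.measurable_reward x a)).ennreal_toReal

variable [DiscreteMeasurableSpace S]

@[fun_prop]
theorem MDP.measurable_transProb (x : S) (a : A) (y : S) :
    Measurable fun M : MDP S A => M.transProb x a y :=
  ((Measure.measurable_coe (measurableSet_singleton y)).comp
    (MDP.measurable_trans x a)).ennreal_toReal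

@[fun_prop]
theorem MDP.measurable_initProb (y : S) : Measurable fun M : MDP S A => M.initProb y :=
  ((Measure.measurable_coe (measurableSet_singleton y)).comp
    MDP.measurable_init).ennreal_toReal

theorem MDP.measurable_value [Fintype S] {τ : ℕ} (μ : Policy S A τ) (i : Fin τ) (x : S) :
    Measurable fun M : MDP S A => M.value μ i x := by
  unfold MDP.value MDP.pathProb
  refine Finset.measurable_sum _ fun z _ => Measurable.mul (Measurable.mul measurable_const ?_) ?_
  · exact Finset.measurable_prod _ fun j _ => MDP.measurable_transProb _ _ _
  · exact Finset.measurable_sum _ fun j _ => MDP.measurable_meanReward _ _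

theorem MDP.measurable_value_policy [Fintype S] [Finite A] [MeasurableSpace A]
    [DiscreteMeasurableSpace A] {τ : ℕ}
    {Ω : Type*} {m : MeasurableSpace Ω} {M : Ω → MDP S A} {μ : Ω → Policy S A τ} (hM : Measurable M)
    (hμ : Measurable μ) (i : Fin τ) (x : S) :
    Measurable fun ω => (M ω).value (μ ω) i x := by
  have h : ∀ g : Policy S A τ × MDP S A → ℝ, (∀ ν, Measurable fun N => g (ν, N)) →
      Measurable fun ω => g (μ ω, M ω) := fun g hg =>
    (measurable_from_prod_countable_right hg).comp (hμ.prodMk hM)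
  exact h (fun p => p.2.value p.1 i x) fun ν => MDP.measurable_value ν i x

end Measurability

section Conditional

variable {Ω : Type*} {m' m mΩ : MeasurableSpace Ω} {P : Measure Ω}

/-- If `y` is a version of the conditional expectation of `Y`, then `Y` can be replaced by `y`
inside an expectation against a bounded random variable that is measurable for the conditioning
σ-algebra. -/
theorem integral_mul_eq_of_condExp_eq [IsProbabilityMeasure P] (hm : m ≤ mΩ) {Y y Z : Ω → ℝ}
    (hY : Integrable Y P) (h : P[Y | m] =ᵐ[P] y) (hZ : Measurable[m] Z) (c : ℝ)
    (hZc : ∀ ω, |Z ω| ≤ c) : ∫ ω, Z ω * Y ω ∂P = ∫ ω, Z ω * y ω ∂P := by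
  have h1 := condExp_stronglyMeasurable_mul_of_bound hm hZ.stronglyMeasurable hY c
    (ae_of_all _ hZc)
  calc ∫ ω, Z ω * Y ω ∂P = ∫ ω, (P[Z * Y | m]) ω ∂P := (integral_condExp hm).symm
    _ = ∫ ω, Z ω * y ω ∂P := by
      refine integral_congr_ae ?_
      filter_upwards [h1, h] with ω h1 h2
      rw [h1, Pi.mul_apply, h2]

theorem condExp_mul_eq [IsProbabilityMeasure P] (hm : m ≤ mΩ) {Y y Z : Ω → ℝ}
    (hY : Integrable Y P) (h : P[Y | m] =ᵐ[P] y) (hZ : Measurable[m] Z) (c : ℝ)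
    (hZc : ∀ ω, |Z ω| ≤ c) : P[fun ω => Z ω * Y ω | m] =ᵐ[P] fun ω => Z ω * y ω := by
  have h1 := condExp_stronglyMeasurable_mul_of_bound hm hZ.stronglyMeasurable hY c
    (ae_of_all _ hZc)
  filter_upwards [h1, h] with ω h1 h2
  rw [← h2]
  exact h1

/-- If `κ` is a conditional distribution of the random variable `r` with values in `[0,1]`, then
the mean of `κ` is the conditional expectation of `r`. -/
theorem condExp_unitInterval_eq_integral [IsProbabilityMeasure P] (hm : m ≤ mΩ)
    {r : Ω → unitInterval} (hr : Measurable r) {κ : Ω → Measure unitInterval}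
    (hκ : Measurable[m] κ) (hκp : ∀ ω, IsProbabilityMeasure (κ ω))
    (h : ∀ B, MeasurableSet B → P⟦r ⁻¹' B | m⟧ =ᵐ[P] fun ω => (κ ω).real B) :
    P[fun ω => (r ω : ℝ) | m] =ᵐ[P] fun ω => ∫ u : unitInterval, (u : ℝ) ∂(κ ω) := by
  have hg : Measurable fun u : unitInterval => ENNReal.ofReal u :=
    ENNReal.measurable_ofReal.comp measurable_subtype_coe
  have hmean : ∀ ω, ∫ u : unitInterval, (u : ℝ) ∂(κ ω) =
      (∫⁻ u : unitInterval, ENNReal.ofReal u ∂(κ ω)).toReal := fun ω =>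
    integral_eq_lintegral_of_nonneg_ae (ae_of_all _ fun u => u.2.1)
      measurable_subtype_coe.aestronglyMeasurable
  have hle : ∀ ω, ∫⁻ u : unitInterval, ENNReal.ofReal u ∂(κ ω) ≤ 1 := fun ω => by
    calc ∫⁻ u : unitInterval, ENNReal.ofReal u ∂(κ ω) ≤ ∫⁻ _ : unitInterval, 1 ∂(κ ω) :=
          lintegral_mono fun u => ENNReal.ofReal_le_one.2 u.2.2
      _ = 1 := by simp
  have hlm : Measurable[m] fun ω => ∫⁻ u : unitInterval, ENNReal.ofReal u ∂(κ ω) :=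
    (Measure.measurable_lintegral hg).comp hκ
  have hmm : Measurable[m] fun ω => ∫ u : unitInterval, (u : ℝ) ∂(κ ω) := by
    simp_rw [hmean]
    exact hlm.ennreal_toReal
  have hrm : Measurable fun ω => (r ω : ℝ) := measurable_subtype_coe.comp hr
  have hint : Integrable (fun ω => (r ω : ℝ)) P :=
    Integrable.of_mem_Icc 0 1 hrm.aemeasurable (ae_of_all _ fun ω => (r ω).2)
  refine (ae_eq_condExp_of_forall_setIntegral_eq hm hint ?_ ?_ hmm.aestronglyMeasurable).symm
  · intro G _ _
    refine (Integrable.of_mem_Icc 0 1 (hmm.mono hm le_rfl).aemeasurable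
      (ae_of_all _ fun ω => ⟨integral_nonneg fun u => u.2.1, ?_⟩)).integrableOn
    rw [hmean]
    exact ENNReal.toReal_le_of_le_ofReal zero_le_one (by simpa using hle ω)
  · intro G hG _
    have hκ' : Measurable κ := hκ.mono hm le_rfl
    have hlaw : (P.restrict G).map r = (P.restrict G).bind κ := by
      ext B hB
      rw [Measure.map_apply hr hB, Measure.bind_apply hB hκ'.aemeasurable,
        Measure.restrict_apply (hr hB)]
      have hB' : Measurable fun ω => κ ω B := (Measure.measurable_coe hB).comp hκ'
      have h1 : ∫ ω in G, (r ⁻¹' B).indicator (fun _ => (1 : ℝ)) ω ∂P =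
          ∫ ω in G, (κ ω).real B ∂P := by
        rw [← setIntegral_condExp hm ((integrable_const _).indicator (hr hB)) hG]
        exact integral_congr_ae (ae_restrict_of_ae (h B hB))
      rw [integral_indicator (hr hB), setIntegral_const, smul_eq_mul, mul_one,
        measureReal_restrict_apply (hr hB)] at h1
      simp only [measureReal_def] at h1
      rw [integral_toReal hB'.aemeasurable (ae_of_all _ fun ω => measure_lt_top _ _)] at h1
      refine (ENNReal.toReal_eq_toReal_iff' (measure_ne_top _ _) ?_).1 h1
      have : ∫⁻ ω in G, κ ω B ∂P ≤ 1 := by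
        calc ∫⁻ ω in G, κ ω B ∂P ≤ ∫⁻ _ in G, 1 ∂P := lintegral_mono fun ω => prob_le_one
          _ ≤ 1 := by simpa using prob_le_one
      exact (this.trans_lt ENNReal.one_lt_top).ne
    have h2 : ∫⁻ ω in G, ENNReal.ofReal (r ω) ∂P =
        ∫⁻ ω in G, ∫⁻ u : unitInterval, ENNReal.ofReal u ∂(κ ω) ∂P := by
      rw [← lintegral_map (f := fun u : unitInterval => ENNReal.ofReal u) hg hr, hlaw,
        Measure.lintegral_bind hκ'.aemeasurable hg.aemeasurable]
    simp_rw [hmean]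
    rw [integral_toReal (hlm.mono hm le_rfl).aemeasurable
      (ae_of_all _ fun ω => (hle ω).trans_lt ENNReal.one_lt_top), ← h2,
      integral_eq_lintegral_of_nonneg_ae (ae_of_all _ fun ω => (r ω).2.1)
        hrm.aestronglyMeasurable]

/-- If the conditional probabilities of the events `U ∈ B` are those of `V ∈ B` given a smaller
σ-algebra, then `U` and `V` have the same joint distribution with each random variable that is
measurable for the smaller one. -/
theorem identDistrib_prodMk_of_condExp_eq [IsProbabilityMeasure P] {E F : Type*}
    {mE : MeasurableSpace E} {mF : MeasurableSpace F} (hm : m ≤ mΩ)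
    (hm' : m' ≤ m) {U V : Ω → E} {W : Ω → F} (hU : Measurable U) (hV : Measurable V)
    (hW : Measurable[m'] W)
    (h : ∀ B, MeasurableSet B → P⟦U ⁻¹' B | m⟧ =ᵐ[P] P⟦V ⁻¹' B | m'⟧) :
    IdentDistrib (fun ω => (U ω, W ω)) (fun ω => (V ω, W ω)) P P := by
  have hWΩ : Measurable W := hW.mono (hm'.trans hm) le_rfl
  refine ⟨(hU.prodMk hWΩ).aemeasurable, (hV.prodMk hWΩ).aemeasurable, ?_⟩
  have := Measure.isProbabilityMeasure_map (μ := P) (hU.prodMk hWΩ).aemeasurable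
  refine Measure.ext_prod fun {B D} hB hD => ?_
  rw [Measure.map_apply (hU.prodMk hWΩ) (hB.prod hD),
    Measure.map_apply (hV.prodMk hWΩ) (hB.prod hD), Set.mk_preimage_prod, Set.mk_preimage_prod]
  have hD' : MeasurableSet[m'] (W ⁻¹' D) := hW hD
  have h1 : ∫ ω in W ⁻¹' D, (U ⁻¹' B).indicator (fun _ => (1 : ℝ)) ω ∂P =
      ∫ ω in W ⁻¹' D, (V ⁻¹' B).indicator (fun _ => (1 : ℝ)) ω ∂P := by
    rw [← setIntegral_condExp hm ((integrable_const _).indicator (hU hB)) (hm' _ hD'),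
      ← setIntegral_condExp (f := (V ⁻¹' B).indicator fun _ => (1 : ℝ)) (hm'.trans hm)
        ((integrable_const _).indicator (hV hB)) hD']
    exact integral_congr_ae (ae_restrict_of_ae (h B hB))
  rw [integral_indicator (hU hB), integral_indicator (hV hB), setIntegral_const,
    setIntegral_const, smul_eq_mul, smul_eq_mul, mul_one, mul_one,
    measureReal_restrict_apply (hU hB), measureReal_restrict_apply (hV hB)] at h1
  exact (measureReal_eq_measureReal_iff).1 h1

end Conditional

section Counting

variable {Ω : Type*} {mΩ : MeasurableSpace Ω} {P : Measure Ω}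

/-- The partial sums of a sequence of random variables. -/
def partialSum (X : ℕ → Ω → ℝ) (n : ℕ) (ω : Ω) : ℝ := ∑ u ∈ Finset.range n, X u ω

theorem partialSum_succ (X : ℕ → Ω → ℝ) (n : ℕ) (ω : Ω) :
    partialSum X (n + 1) ω = partialSum X n ω + X n ω :=
  Finset.sum_range_succ _ _

theorem measurable_partialSum {m : MeasurableSpace Ω} {X : ℕ → Ω → ℝ} {n : ℕ}
    (h : ∀ u < n, Measurable[m] (X u)) : Measurable[m] (partialSum X n) :=
  Finset.measurable_sum _ fun u hu => h u (Finset.mem_range.1 hu)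

theorem abs_partialSum_le {X : ℕ → Ω → ℝ} {ω : Ω} (h : ∀ u, |X u ω| ≤ 1) (n : ℕ) :
    |partialSum X n ω| ≤ n := by
  calc |partialSum X n ω| ≤ ∑ u ∈ Finset.range n, |X u ω| := Finset.abs_sum_le_sum_abs _ _
    _ ≤ ∑ u ∈ Finset.range n, (1 : ℝ) := Finset.sum_le_sum fun u _ => h u
    _ = n := by simp

theorem partialSum_nonneg {X : ℕ → Ω → ℝ} {ω : Ω} (h : ∀ u, 0 ≤ X u ω) (n : ℕ) :
    0 ≤ partialSum X n ω :=
  Finset.sum_nonneg fun u _ => h u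

theorem inv_add_two_le_log_sub_log {x : ℝ} (hx : 0 ≤ x) :
    1 / (x + 2) ≤ Real.log (x + 1 + 1) - Real.log (x + 1) := by
  have h := Real.one_sub_inv_le_log_of_pos (x := (x + 1 + 1) / (x + 1)) (by positivity)
  rw [Real.log_div (by positivity) (by positivity)] at h
  refine le_trans (le_of_eq ?_) h
  field_simp
  ring

theorem sum_div_le_log {I : ℕ → Ω → ℝ} {ω : Ω} (hI : ∀ u, I u ω = 0 ∨ I u ω = 1) (n : ℕ) :
    ∑ u ∈ Finset.range n, I u ω / (partialSum I u ω + 2) ≤ Real.log (partialSum I n ω + 1) := by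
  have h0 : ∀ n, 0 ≤ partialSum I n ω := partialSum_nonneg fun u => by
    rcases hI u with h | h <;> simp [h]
  induction n with
  | zero => simp [partialSum]
  | succ n ih =>
    rw [Finset.sum_range_succ, partialSum_succ]
    rcases hI n with h | h
    · simpa [h] using ih
    · have := inv_add_two_le_log_sub_log (h0 n)
      rw [h]
      linarith

/-- Self-normalized second-moment bound: for conditionally centred noise `ξ` bounded by `1`,
observed at the times with `I = 1`, the expectation of `(∑ I ξ)² / (∑ I + 1)` grows at most
logarithmically. -/
theorem integral_sq_partialSum_div_le [IsProbabilityMeasure P] {I ξ : ℕ → Ω → ℝ}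
    (hIm : ∀ u, Measurable (I u)) (hξm : ∀ u, Measurable (ξ u))
    (hI : ∀ u ω, I u ω = 0 ∨ I u ω = 1) (hξ : ∀ u ω, |ξ u ω| ≤ 1)
    (h0 : ∀ u, ∫ ω, partialSum (fun v ω => I v ω * ξ v ω) u ω / (partialSum I u ω + 2) *
      (I u ω * ξ u ω) ∂P = 0) (n : ℕ) :
    ∫ ω, partialSum (fun v ω => I v ω * ξ v ω) n ω ^ 2 / (partialSum I n ω + 1) ∂P ≤
      Real.log (n + 1) := by
  set X := partialSum (fun v ω => I v ω * ξ v ω) with hX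
  set N := partialSum I with hN
  have hI1 : ∀ u ω, |I u ω| ≤ 1 := fun u ω => by rcases hI u ω with h | h <;> simp [h]
  have hIξ : ∀ u ω, |I u ω * ξ u ω| ≤ 1 := fun u ω => by
    rw [abs_mul]; exact mul_le_one₀ (hI1 u ω) (abs_nonneg _) (hξ u ω)
  have hN0 : ∀ n ω, 0 ≤ N n ω := fun n ω => partialSum_nonneg (fun u => by
    rcases hI u ω with h | h <;> simp [h]) n
  have hNn : ∀ n ω, N n ω ≤ n := fun n ω =>
    (le_abs_self _).trans (abs_partialSum_le (fun u => hI1 u ω) n)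
  have hXn : ∀ n ω, |X n ω| ≤ n := fun n ω => abs_partialSum_le (fun u => hIξ u ω) n
  have hNm : ∀ n, Measurable (N n) := fun n => measurable_partialSum fun u _ => hIm u
  have hXm : ∀ n, Measurable (X n) := fun n =>
    measurable_partialSum fun u _ => (hIm u).mul (hξm u)
  have hi1 : ∀ n, Integrable (fun ω => X n ω ^ 2 / (N n ω + 1)) P := fun n => by
    refine Integrable.of_mem_Icc 0 ((n : ℝ) ^ 2) (by fun_prop)
      (ae_of_all _ fun ω => ⟨div_nonneg (sq_nonneg _) (by linarith [hN0 n ω]), ?_⟩)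
    refine (div_le_self (sq_nonneg _) (by linarith [hN0 n ω])).trans ?_
    rw [← sq_abs]
    exact pow_le_pow_left₀ (abs_nonneg _) (hXn n ω) 2
  have hi2 : ∀ n, Integrable (fun ω => Real.log (N n ω + 1)) P := fun n => by
    refine Integrable.of_mem_Icc 0 (Real.log (n + 1)) (by fun_prop)
      (ae_of_all _ fun ω => ⟨Real.log_nonneg (by linarith [hN0 n ω]),
        Real.log_le_log (by linarith [hN0 n ω]) (by linarith [hNn n ω])⟩)
  have hi3 : ∀ n, Integrable (fun ω => X n ω / (N n ω + 2) * (I n ω * ξ n ω)) P := fun n => by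
    refine Integrable.of_bound (by fun_prop) (n : ℝ) (ae_of_all _ fun ω => ?_)
    rw [Real.norm_eq_abs, abs_mul, abs_div]
    have h1 : (1 : ℝ) ≤ |N n ω + 2| := by
      rw [abs_of_nonneg] <;> linarith [hN0 n ω]
    exact (mul_le_of_le_one_right (by positivity) (hIξ n ω)).trans
      ((div_le_self (abs_nonneg _) h1).trans (hXn n ω))
  have key : ∀ n, ∫ ω, X n ω ^ 2 / (N n ω + 1) ∂P ≤ ∫ ω, Real.log (N n ω + 1) ∂P := by
    intro n
    induction n with
    | zero => simp [hX, hN, partialSum]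
    | succ n ih =>
      have hpt : ∀ ω, X (n + 1) ω ^ 2 / (N (n + 1) ω + 1) + Real.log (N n ω + 1) ≤
          X n ω ^ 2 / (N n ω + 1) + Real.log (N (n + 1) ω + 1) +
            2 * (X n ω / (N n ω + 2) * (I n ω * ξ n ω)) := by
        intro ω
        have e1 : X (n + 1) ω = X n ω + I n ω * ξ n ω := partialSum_succ _ _ _
        have e2 : N (n + 1) ω = N n ω + I n ω := partialSum_succ _ _ _
        rw [e1, e2]
        rcases hI n ω with h | h
        · simp [h]
        · have hl := inv_add_two_le_log_sub_log (hN0 n ω)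
          have hx : X n ω ^ 2 / (N n ω + 2) ≤ X n ω ^ 2 / (N n ω + 1) :=
            div_le_div_of_nonneg_left (sq_nonneg _) (by linarith [hN0 n ω]) (by linarith)
          have hs : ξ n ω ^ 2 / (N n ω + 2) ≤ 1 / (N n ω + 2) := by
            refine div_le_div_of_nonneg_right ?_ (by linarith [hN0 n ω])
            rw [← sq_abs]
            exact pow_le_one₀ (abs_nonneg _) (hξ n ω)
          have he : (X n ω + 1 * ξ n ω) ^ 2 / (N n ω + 1 + 1) = X n ω ^ 2 / (N n ω + 2) +
              2 * (X n ω / (N n ω + 2) * (1 * ξ n ω)) + ξ n ω ^ 2 / (N n ω + 2) := by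
            have : N n ω + 2 ≠ 0 := by linarith [hN0 n ω]
            rw [add_assoc (N n ω), one_add_one_eq_two]
            field_simp
            ring
          rw [h, he]
          linarith
      have hs : Integrable (fun ω => X n ω ^ 2 / (N n ω + 1) + Real.log (N (n + 1) ω + 1)) P :=
        (hi1 n).add (hi2 (n + 1))
      have hi := integral_mono ((hi1 (n + 1)).add (hi2 n)) (hs.add ((hi3 n).const_mul 2)) hpt
      simp only [Pi.add_apply] at hi
      rw [integral_add (hi1 (n + 1)) (hi2 n), integral_add hs ((hi3 n).const_mul 2),
        integral_add (hi1 n) (hi2 (n + 1)), integral_const_mul, h0 n] at hi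
      linarith
  refine (key n).trans ?_
  calc ∫ ω, Real.log (N n ω + 1) ∂P ≤ ∫ _, Real.log (n + 1) ∂P :=
        integral_mono (hi2 n) (integrable_const _) fun ω =>
          Real.log_le_log (by linarith [hN0 n ω]) (by linarith [hNn n ω])
    _ = Real.log (n + 1) := by simp

end Counting

section Estimation

variable {Ω : Type*} {mΩ : MeasurableSpace Ω} {P : Measure Ω}

/-- The random variables `Y u`, observed at the times `u` with `I u = 1`, are unbiased observations
of the random parameter `ϑ` in `[0,1]`; what is observed before the time `k * τ` is measurable for
`ℱ (k * τ)`. -/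
structure IsObservation (P : Measure Ω) (τ : ℕ) (ℱ : ℕ → MeasurableSpace Ω) (ϑ : Ω → ℝ)
    (I Y : ℕ → Ω → ℝ) : Prop where
  measurable_param : Measurable ϑ
  param_mem : ∀ ω, ϑ ω ∈ Set.Icc (0 : ℝ) 1
  measurable_I : ∀ u, Measurable (I u)
  measurable_Y : ∀ u, Measurable (Y u)
  I_eq : ∀ u ω, I u ω = 0 ∨ I u ω = 1
  Y_mem : ∀ u ω, Y u ω ∈ Set.Icc (0 : ℝ) 1
  history_I : ∀ k u, u < k * τ → Measurable[ℱ (k * τ)] (I u)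
  history_mul : ∀ k u, u < k * τ → Measurable[ℱ (k * τ)] fun ω => I u ω * Y u ω
  unbiased : ∀ u, ∃ m ≤ mΩ, (∀ v < u, Measurable[m] (I v)) ∧
    (∀ v < u, Measurable[m] fun ω => I v ω * Y v ω) ∧ Measurable[m] ϑ ∧
    P[fun ω => I u ω * Y u ω | m] =ᵐ[P] fun ω => I u ω * ϑ ω

variable {τ : ℕ} {ℱ : ℕ → MeasurableSpace Ω} {ϑ : Ω → ℝ} {I Y : ℕ → Ω → ℝ}

theorem IsObservation.I_nonneg (h : IsObservation P τ ℱ ϑ I Y) (u : ℕ) (ω : Ω) : 0 ≤ I u ω := by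
  rcases h.I_eq u ω with h | h <;> simp [h]

theorem IsObservation.I_le_one (h : IsObservation P τ ℱ ϑ I Y) (u : ℕ) (ω : Ω) : I u ω ≤ 1 := by
  rcases h.I_eq u ω with h | h <;> simp [h]

theorem IsObservation.abs_I_le (h : IsObservation P τ ℱ ϑ I Y) (u : ℕ) (ω : Ω) : |I u ω| ≤ 1 := by
  rw [abs_of_nonneg (h.I_nonneg u ω)]; exact h.I_le_one u ω

theorem IsObservation.count_nonneg (h : IsObservation P τ ℱ ϑ I Y) (n : ℕ) (ω : Ω) :
    0 ≤ partialSum I n ω :=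
  partialSum_nonneg (fun u => h.I_nonneg u ω) n

theorem IsObservation.count_le (h : IsObservation P τ ℱ ϑ I Y) (n : ℕ) (ω : Ω) :
    partialSum I n ω ≤ n :=
  (le_abs_self _).trans (abs_partialSum_le (fun u => h.abs_I_le u ω) n)

theorem IsObservation.measurable_count (h : IsObservation P τ ℱ ϑ I Y) (n : ℕ) :
    Measurable (partialSum I n) :=
  measurable_partialSum fun u _ => h.measurable_I u

theorem IsObservation.abs_sub_le (h : IsObservation P τ ℱ ϑ I Y) (u : ℕ) (ω : Ω) :
    |Y u ω - ϑ ω| ≤ 1 := by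
  have h1 := h.Y_mem u ω
  have h2 := h.param_mem ω
  exact abs_le.2 ⟨by linarith [h1.1, h2.2], by linarith [h1.2, h2.1]⟩

theorem IsObservation.abs_mul_sub_le (h : IsObservation P τ ℱ ϑ I Y) (u : ℕ) (ω : Ω) :
    |I u ω * (Y u ω - ϑ ω)| ≤ 1 := by
  rw [abs_mul]
  exact mul_le_one₀ (h.abs_I_le u ω) (abs_nonneg _) (h.abs_sub_le u ω)

theorem IsObservation.integral_sq_noise_le [IsProbabilityMeasure P]
    (h : IsObservation P τ ℱ ϑ I Y) (n : ℕ) :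
    ∫ ω, partialSum (fun v ω => I v ω * (Y v ω - ϑ ω)) n ω ^ 2 / (partialSum I n ω + 1) ∂P ≤
      Real.log (n + 1) := by
  refine integral_sq_partialSum_div_le (ξ := fun u ω => Y u ω - ϑ ω) h.measurable_I
    (fun u => (h.measurable_Y u).sub h.measurable_param) h.I_eq h.abs_sub_le (fun u => ?_) n
  obtain ⟨m, hm, hI, hIY, hϑ, hc⟩ := h.unbiased u
  have hXm : Measurable[m] (partialSum (fun v ω => I v ω * (Y v ω - ϑ ω)) u) := by
    refine measurable_partialSum fun v hv => ?_
    simp_rw [mul_sub]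
    exact (hIY v hv).sub ((hI v hv).mul hϑ)
  have hNm : Measurable[m] (partialSum I u) := measurable_partialSum hI
  have hZm : Measurable[m] fun ω => partialSum (fun v ω => I v ω * (Y v ω - ϑ ω)) u ω /
      (partialSum I u ω + 2) := hXm.div (hNm.add_const 2)
  have hZb : ∀ ω, |partialSum (fun v ω => I v ω * (Y v ω - ϑ ω)) u ω /
      (partialSum I u ω + 2)| ≤ u := fun ω => by
    have h0 := h.count_nonneg u ω
    rw [abs_div, abs_of_nonneg (by linarith : 0 ≤ partialSum I u ω + 2)]
    exact (div_le_self (abs_nonneg _) (by linarith)).trans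
      (abs_partialSum_le (fun v => h.abs_mul_sub_le v ω) u)
  have hi1 : Integrable (fun ω => I u ω * Y u ω) P :=
    Integrable.of_mem_Icc 0 1 ((h.measurable_I u).mul (h.measurable_Y u)).aemeasurable
      (ae_of_all _ fun ω => ⟨mul_nonneg (h.I_nonneg u ω) (h.Y_mem u ω).1,
        mul_le_one₀ (h.I_le_one u ω) (h.Y_mem u ω).1 (h.Y_mem u ω).2⟩)
  have hi2 : Integrable (fun ω => I u ω * ϑ ω) P :=
    Integrable.of_mem_Icc 0 1 ((h.measurable_I u).mul h.measurable_param).aemeasurable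
      (ae_of_all _ fun ω => ⟨mul_nonneg (h.I_nonneg u ω) (h.param_mem ω).1,
        mul_le_one₀ (h.I_le_one u ω) (h.param_mem ω).1 (h.param_mem ω).2⟩)
  have he := integral_mul_eq_of_condExp_eq hm hi1 hc hZm u hZb
  have hZ : AEStronglyMeasurable[mΩ] (fun ω => partialSum (fun v ω => I v ω * (Y v ω - ϑ ω)) u ω /
      (partialSum I u ω + 2)) P := (hZm.mono hm le_rfl).aestronglyMeasurable
  simp_rw [mul_sub (I u _)]
  simp_rw [mul_sub (_ / _)]
  rw [integral_sub (hi1.bdd_mul hZ (ae_of_all _ hZb)) (hi2.bdd_mul hZ (ae_of_all _ hZb))]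
  exact sub_eq_zero.2 he

variable {E : Type*} {mE : MeasurableSpace E} {Mstar : Ω → E} {Msamp : ℕ → Ω → E} {θ : E → ℝ}

/-- The mean square distance between the parameters of the true and of the sampled model, weighted
with the number of observations. -/
theorem IsObservation.integral_count_mul_sq_le [IsProbabilityMeasure P]
    (h : IsObservation P τ ℱ (fun ω => θ (Mstar ω)) I Y) (hθ : Measurable θ)
    (hθ01 : ∀ M, θ M ∈ Set.Icc (0 : ℝ) 1) (k : ℕ) (hk : Measurable (Msamp k))
    (hpost : ∀ W : Ω → ℝ × ℝ, Measurable[ℱ (k * τ)] W →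
      IdentDistrib (fun ω => (Msamp k ω, W ω)) (fun ω => (Mstar ω, W ω)) P P) :
    ∫ ω, (partialSum I (k * τ) ω + 1) * (θ (Msamp k ω) - θ (Mstar ω)) ^ 2 ∂P ≤
      8 + 8 * Real.log ((k * τ : ℕ) + 1) := by
  set n := k * τ with hn
  set N := partialSum I n with hN
  set G := partialSum (fun u ω => I u ω * Y u ω) n with hG
  set X := partialSum (fun v ω => I v ω * (Y v ω - θ (Mstar ω))) n with hX
  have hNm : Measurable N := h.measurable_count n
  have hN0 : ∀ ω, 0 ≤ N ω := h.count_nonneg n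
  have hNn : ∀ ω, N ω ≤ n := h.count_le n
  have hGm : Measurable G := measurable_partialSum fun u _ =>
    (h.measurable_I u).mul (h.measurable_Y u)
  have hXm : Measurable X := measurable_partialSum fun u _ =>
    (h.measurable_I u).mul ((h.measurable_Y u).sub h.measurable_param)
  have hXn : ∀ ω, |X ω| ≤ n := fun ω => abs_partialSum_le (fun v => h.abs_mul_sub_le v ω) n
  have hXG : ∀ ω, X ω = G ω - N ω * θ (Mstar ω) := fun ω => by
    simp only [hX, hG, hN, partialSum, mul_sub, Finset.sum_sub_distrib, Finset.sum_mul]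
  have hMs : Measurable fun ω => θ (Mstar ω) := h.measurable_param
  have hMk : Measurable fun ω => θ (Msamp k ω) := hθ.comp hk
  -- the squared error of the estimator `G / (N + 1)`
  have hW : Measurable[ℱ n] fun ω => (N ω, G ω / (N ω + 1)) := by
    have h1 : Measurable[ℱ n] N := measurable_partialSum (h.history_I k)
    have h2 : Measurable[ℱ n] G := measurable_partialSum (h.history_mul k)
    exact h1.prodMk (h2.div (h1.add_const 1))
  have hid := (hpost _ hW).comp
    (u := fun p : E × ℝ × ℝ => (p.2.1 + 1) * (θ p.1 - p.2.2) ^ 2) (by fun_prop)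
  have hsq : ∀ ω, (N ω + 1) * (θ (Mstar ω) - G ω / (N ω + 1)) ^ 2 ≤
      2 + 2 * (X ω ^ 2 / (N ω + 1)) := fun ω => by
    have h0 : 0 < N ω + 1 := by linarith [hN0 ω]
    have e : (N ω + 1) * (θ (Mstar ω) - G ω / (N ω + 1)) ^ 2 =
        (θ (Mstar ω) - X ω) ^ 2 / (N ω + 1) := by
      rw [hXG]; field_simp; ring
    have h1 : (θ (Mstar ω) - X ω) ^ 2 ≤ 2 + 2 * X ω ^ 2 := by
      have := pow_le_one₀ (hθ01 (Mstar ω)).1 (hθ01 (Mstar ω)).2 (n := 2)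
      nlinarith [sq_nonneg (θ (Mstar ω) + X ω)]
    rw [e]
    calc (θ (Mstar ω) - X ω) ^ 2 / (N ω + 1) ≤ (2 + 2 * X ω ^ 2) / (N ω + 1) := by gcongr
      _ = 2 / (N ω + 1) + 2 * (X ω ^ 2 / (N ω + 1)) := by ring
      _ ≤ 2 + 2 * (X ω ^ 2 / (N ω + 1)) := by
        gcongr
        exact div_le_self zero_le_two (by linarith [hN0 ω])
  have hiX : Integrable (fun ω => X ω ^ 2 / (N ω + 1)) P := by
    refine Integrable.of_mem_Icc 0 ((n : ℝ) ^ 2) (by fun_prop)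
      (ae_of_all _ fun ω => ⟨div_nonneg (sq_nonneg _) (by linarith [hN0 ω]), ?_⟩)
    refine (div_le_self (sq_nonneg _) (by linarith [hN0 ω])).trans ?_
    rw [← sq_abs]
    exact pow_le_pow_left₀ (abs_nonneg _) (hXn ω) 2
  have hib : Integrable (fun ω => 2 + 2 * (X ω ^ 2 / (N ω + 1))) P :=
    (integrable_const _).add (hiX.const_mul 2)
  have his : Integrable (fun ω => (N ω + 1) * (θ (Mstar ω) - G ω / (N ω + 1)) ^ 2) P := by
    refine hib.mono' ((hNm.add_const 1).mul
      ((hMs.sub (hGm.div (hNm.add_const 1))).pow_const 2)).aestronglyMeasurable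
      (ae_of_all _ fun ω => ?_)
    rw [Real.norm_of_nonneg (mul_nonneg (by linarith [hN0 ω]) (sq_nonneg _))]
    exact hsq ω
  have hik : Integrable (fun ω => (N ω + 1) * (θ (Msamp k ω) - G ω / (N ω + 1)) ^ 2) P :=
    hid.integrable_iff.2 his
  have hs : ∫ ω, (N ω + 1) * (θ (Mstar ω) - G ω / (N ω + 1)) ^ 2 ∂P ≤ 2 + 2 * Real.log (n + 1) := by
    refine (integral_mono his hib hsq).trans ?_
    rw [integral_add (integrable_const _) (hiX.const_mul 2), integral_const_mul]
    have := h.integral_sq_noise_le n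
    simp only [integral_const, probReal_univ, smul_eq_mul, one_mul]
    linarith
  have hk' : ∫ ω, (N ω + 1) * (θ (Msamp k ω) - G ω / (N ω + 1)) ^ 2 ∂P ≤
      2 + 2 * Real.log (n + 1) := hid.integral_eq.trans_le hs
  have hpt : ∀ ω, (N ω + 1) * (θ (Msamp k ω) - θ (Mstar ω)) ^ 2 ≤
      2 * ((N ω + 1) * (θ (Msamp k ω) - G ω / (N ω + 1)) ^ 2) +
      2 * ((N ω + 1) * (θ (Mstar ω) - G ω / (N ω + 1)) ^ 2) := fun ω => by
    have h0 : 0 ≤ N ω + 1 := by linarith [hN0 ω]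
    generalize G ω / (N ω + 1) = g
    have : (θ (Msamp k ω) - θ (Mstar ω)) ^ 2 ≤
        2 * (θ (Msamp k ω) - g) ^ 2 + 2 * (θ (Mstar ω) - g) ^ 2 := by
      nlinarith [sq_nonneg (θ (Msamp k ω) + θ (Mstar ω) - 2 * g)]
    calc _ ≤ (N ω + 1) * (2 * (θ (Msamp k ω) - g) ^ 2 + 2 * (θ (Mstar ω) - g) ^ 2) := by gcongr
      _ = _ := by ring
  have hr : Integrable (fun ω => 2 * ((N ω + 1) * (θ (Msamp k ω) - G ω / (N ω + 1)) ^ 2) +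
      2 * ((N ω + 1) * (θ (Mstar ω) - G ω / (N ω + 1)) ^ 2)) P :=
    (hik.const_mul 2).add (his.const_mul 2)
  refine (integral_mono_of_nonneg (ae_of_all _ fun ω => mul_nonneg
    (by linarith [hN0 ω]) (sq_nonneg _)) hr (ae_of_all _ hpt)).trans ?_
  rw [integral_add (hik.const_mul 2) (his.const_mul 2), integral_const_mul, integral_const_mul]
  linarith

theorem IsObservation.count_add_le (h : IsObservation P τ ℱ ϑ I Y) (n j : ℕ) (ω : Ω) :
    partialSum I (n + j) ω ≤ partialSum I n ω + j := by
  induction j with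
  | zero => simp
  | succ j ih =>
    rw [← add_assoc, partialSum_succ]
    push_cast
    linarith [h.I_le_one (n + j) ω]

/-- The expected total distance between the parameters of the true and of the sampled models. -/
theorem IsObservation.integral_sum_abs_sub_le [IsProbabilityMeasure P]
    (h : IsObservation P τ ℱ (fun ω => θ (Mstar ω)) I Y) (hτ : 0 < τ) (hθ : Measurable θ)
    (hθ01 : ∀ M, θ M ∈ Set.Icc (0 : ℝ) 1) (hk : ∀ k, Measurable (Msamp k))
    (hpost : ∀ k, ∀ W : Ω → ℝ × ℝ, Measurable[ℱ (k * τ)] W →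
      IdentDistrib (fun ω => (Msamp k ω, W ω)) (fun ω => (Mstar ω, W ω)) P P) (K : ℕ) :
    ∑ u ∈ Finset.range (K * τ), ∫ ω, I u ω * |θ (Msamp (u / τ) ω) - θ (Mstar ω)| ∂P ≤
      9 * (τ + 1) * (√K * (1 + Real.log ((K * τ : ℕ) + 1))) := by
  rcases Nat.eq_zero_or_pos K with rfl | hK
  · simp
  have hs : 0 < √(K : ℝ) := Real.sqrt_pos.2 (by exact_mod_cast hK)
  have hMs : Measurable fun ω => θ (Mstar ω) := h.measurable_param
  have hMk : ∀ k, Measurable fun ω => θ (Msamp k ω) := fun k => hθ.comp (hk k)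
  have hNm := h.measurable_count
  have hIm := h.measurable_I
  have hL0 : 0 ≤ Real.log ((K * τ : ℕ) + 1) :=
    Real.log_nonneg (by linarith [(Nat.cast_nonneg (K * τ) : (0 : ℝ) ≤ (K * τ : ℕ))])
  have hd : ∀ k ω, |θ (Msamp k ω) - θ (Mstar ω)| ≤ 1 := fun k ω => by
    have h1 := hθ01 (Msamp k ω)
    have h2 := hθ01 (Mstar ω)
    exact abs_le.2 ⟨by linarith [h1.1, h2.2], by linarith [h1.2, h2.1]⟩
  have hpt : ∀ u ω, I u ω * |θ (Msamp (u / τ) ω) - θ (Mstar ω)| ≤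
      √K * (τ + 1) * (I u ω / (partialSum I u ω + 2)) +
      (√K)⁻¹ * ((partialSum I (u / τ * τ) ω + 1) *
        (θ (Msamp (u / τ) ω) - θ (Mstar ω)) ^ 2) := fun u ω => by
    generalize θ (Msamp (u / τ) ω) - θ (Mstar ω) = d
    have hb := h.count_add_le (u / τ * τ) (u % τ) ω
    rw [Nat.div_add_mod' u τ] at hb
    have hm : ((u % τ : ℕ) : ℝ) + 1 ≤ τ := by exact_mod_cast Nat.mod_lt u hτ
    have h0 := h.count_nonneg (u / τ * τ) ω
    have h1 := h.count_nonneg u ω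
    generalize partialSum I (u / τ * τ) ω = N at hb h0
    have h2 : 0 ≤ (√(K : ℝ))⁻¹ * ((N + 1) * d ^ 2) := by positivity
    rcases h.I_eq u ω with hI | hI
    · simpa [hI] using h2
    · rw [hI, one_mul]
      have hlow : 1 / (N + 1) ≤ (τ + 1) * (1 / (partialSum I u ω + 2)) := by
        rw [mul_one_div, div_le_div_iff₀ (by linarith) (by linarith)]
        nlinarith [(Nat.cast_nonneg τ : (0 : ℝ) ≤ τ)]
      have hN : 0 < N + 1 := by linarith
      have ham : |d| ≤ √K * (1 / (N + 1)) + (√(K : ℝ))⁻¹ * ((N + 1) * d ^ 2) := by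
        have e : √K * (1 / (N + 1)) + (√(K : ℝ))⁻¹ * ((N + 1) * d ^ 2) - 2 * |d| =
            (√K * (1 / (N + 1))) * (1 - (√(K : ℝ))⁻¹ * (N + 1) * |d|) ^ 2 := by
          rw [← sq_abs d]
          field_simp
          ring
        have : 0 ≤ (√K * (1 / (N + 1))) * (1 - (√(K : ℝ))⁻¹ * (N + 1) * |d|) ^ 2 := by positivity
        linarith [abs_nonneg d]
      calc |d| ≤ _ := ham
        _ ≤ √K * ((τ + 1) * (1 / (partialSum I u ω + 2))) + _ := by gcongr
        _ = _ := by ring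
  have hi1 : ∀ u, Integrable (fun ω => I u ω / (partialSum I u ω + 2)) P := fun u => by
    refine Integrable.of_mem_Icc 0 1 (by fun_prop) (ae_of_all _ fun ω => ?_)
    have h0 := h.count_nonneg u ω
    exact ⟨div_nonneg (h.I_nonneg u ω) (by linarith),
      (div_le_self (h.I_nonneg u ω) (by linarith)).trans (h.I_le_one u ω)⟩
  have hi2 : ∀ n k, Integrable (fun ω => (partialSum I n ω + 1) *
      (θ (Msamp k ω) - θ (Mstar ω)) ^ 2) P := fun n k => by
    refine Integrable.of_mem_Icc 0 ((n : ℝ) + 1) (((hNm n).add_const 1).mul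
      (((hMk k).sub hMs).pow_const 2)).aemeasurable (ae_of_all _ fun ω => ?_)
    have h0 := h.count_nonneg n ω
    refine ⟨mul_nonneg (by linarith) (sq_nonneg _), ?_⟩
    refine (mul_le_of_le_one_right (by linarith) ?_).trans (by linarith [h.count_le n ω])
    rw [← sq_abs]
    exact pow_le_one₀ (abs_nonneg _) (hd k ω)
  have hstep : ∀ u ∈ Finset.range (K * τ),
      ∫ ω, I u ω * |θ (Msamp (u / τ) ω) - θ (Mstar ω)| ∂P ≤
      √K * (τ + 1) * ∫ ω, I u ω / (partialSum I u ω + 2) ∂P +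
      (√K)⁻¹ * (8 + 8 * Real.log ((K * τ : ℕ) + 1)) := fun u hu => by
    have hr : Integrable (fun ω => √K * (τ + 1) * (I u ω / (partialSum I u ω + 2)) +
        (√K)⁻¹ * ((partialSum I (u / τ * τ) ω + 1) *
        (θ (Msamp (u / τ) ω) - θ (Mstar ω)) ^ 2)) P :=
      ((hi1 u).const_mul _).add ((hi2 _ _).const_mul _)
    refine (integral_mono_of_nonneg (ae_of_all _ fun ω => mul_nonneg (h.I_nonneg u ω)
      (abs_nonneg _)) hr (ae_of_all _ (hpt u))).trans ?_
    rw [integral_add ((hi1 u).const_mul _) ((hi2 _ _).const_mul _), integral_const_mul,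
      integral_const_mul]
    have h1 := h.integral_count_mul_sq_le hθ hθ01 (u / τ) (hk _) (hpost _)
    have h2 : Real.log ((u / τ * τ : ℕ) + 1) ≤ Real.log ((K * τ : ℕ) + 1) := by
      refine Real.log_le_log (by positivity) ?_
      have : u / τ * τ ≤ K * τ :=
        (Nat.div_mul_le_self u τ).trans (Finset.mem_range.1 hu).le
      exact_mod_cast Nat.add_le_add_right this 1
    gcongr
    linarith
  refine (Finset.sum_le_sum hstep).trans ?_
  rw [Finset.sum_add_distrib, ← Finset.mul_sum, ← integral_finsetSum _ fun u _ => hi1 u]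
  have hlog : ∫ ω, ∑ u ∈ Finset.range (K * τ), I u ω / (partialSum I u ω + 2) ∂P ≤
      Real.log ((K * τ : ℕ) + 1) := by
    calc _ ≤ ∫ _, Real.log ((K * τ : ℕ) + 1) ∂P := by
          refine integral_mono (integrable_finsetSum _ fun u _ => hi1 u) (integrable_const _)
            fun ω => (sum_div_le_log (fun u => h.I_eq u ω) (K * τ)).trans ?_
          exact Real.log_le_log (by linarith [h.count_nonneg (K * τ) ω])
            (by linarith [h.count_le (K * τ) ω])
      _ = _ := by simp
  have hKs : (K : ℝ) * (√K)⁻¹ = √K := by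
    rw [← div_eq_mul_inv, Real.div_sqrt]
  simp only [Finset.sum_const, Finset.card_range, nsmul_eq_mul]
  generalize Real.log ((K * τ : ℕ) + 1) = L at hL0 hlog
  generalize ∫ ω, ∑ u ∈ Finset.range (K * τ), I u ω / (partialSum I u ω + 2) ∂P = J at hlog
  push_cast
  calc √K * (τ + 1) * J + (K : ℝ) * τ * ((√K)⁻¹ * (8 + 8 * L))
      = √K * (τ + 1) * J + (K * (√K)⁻¹) * τ * (8 + 8 * L) := by ring
    _ ≤ √K * (τ + 1) * L + √K * τ * (8 + 8 * L) := by rw [hKs]; gcongr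
    _ ≤ 9 * (τ + 1) * (√K * (1 + L)) := by
      have e : 9 * (τ + 1) * (√K * (1 + L)) - (√K * (τ + 1) * L + √K * τ * (8 + 8 * L)) =
        √(K : ℝ) * (τ + 9 + 8 * L) := by ring
      have : 0 ≤ √(K : ℝ) * (τ + 9 + 8 * L) := by positivity
      linarith

end Estimation

section SigmaAlgebras

variable {Ω S A : Type*} [MeasurableSpace S] [MeasurableSpace A]
  {Mstar : Ω → MDP S A} {Msamp : ℕ → Ω → MDP S A}
  {s : ℕ → Ω → S} {a : ℕ → Ω → A} {r : ℕ → Ω → unitInterval}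

theorem measurable_history_apply {u t : ℕ} (h : u < t) :
    Measurable[historySigma s a r t] fun ω => (s u ω, a u ω, r u ω) :=
  (measurable_pi_apply (⟨u, h⟩ : Fin t)).comp (comap_measurable (history s a r t))

theorem measurable_state {u t : ℕ} (h : u < t) : Measurable[historySigma s a r t] (s u) :=
  measurable_fst.comp (measurable_history_apply (s := s) (a := a) (r := r) h)

theorem measurable_action {u t : ℕ} (h : u < t) : Measurable[historySigma s a r t] (a u) :=
  (measurable_fst.comp measurable_snd).comp
    (measurable_history_apply (s := s) (a := a) (r := r) h)

theorem measurable_reward {u t : ℕ} (h : u < t) : Measurable[historySigma s a r t] (r u) :=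
  (measurable_snd.comp measurable_snd).comp
    (measurable_history_apply (s := s) (a := a) (r := r) h)

theorem measurable_past_Mstar (k t : ℕ) :
    Measurable[pastSigma Mstar Msamp s a r k t] Mstar :=
  measurable_fst.comp (comap_measurable
    (fun ω => (Mstar ω, (fun e : Fin k => Msamp e ω), history s a r t ω)))

theorem measurable_past_Msamp {e k : ℕ} (h : e < k) (t : ℕ) :
    Measurable[pastSigma Mstar Msamp s a r k t] (Msamp e) :=
  (measurable_pi_apply (⟨e, h⟩ : Fin k)).comp ((measurable_fst.comp measurable_snd).comp
    (comap_measurable (fun ω => (Mstar ω, (fun e : Fin k => Msamp e ω), history s a r t ω))))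

theorem historySigma_le_pastSigma (k t : ℕ) :
    historySigma s a r t ≤ pastSigma Mstar Msamp s a r k t :=
  measurable_iff_comap_le.1 ((measurable_snd.comp measurable_snd).comp
    (comap_measurable (fun ω => (Mstar ω, (fun e : Fin k => Msamp e ω), history s a r t ω))))

theorem measurable_comp_state_action {X : Type*} [MeasurableSpace X] [Finite S]
    [DiscreteMeasurableSpace S] [Finite A] [DiscreteMeasurableSpace A] {m : MeasurableSpace Ω}
    {x : Ω → S} {b : Ω → A} {M : Ω → MDP S A} (g : S → A → MDP S A → X)
    (hg : ∀ x b, Measurable (g x b)) (hx : Measurable x) (hb : Measurable b) (hM : Measurable M) :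
    Measurable fun ω => g (x ω) (b ω) (M ω) := by
  have h : Measurable fun p : (S × A) × MDP S A => g p.1.1 p.1.2 p.2 :=
    measurable_from_prod_countable_right fun p => hg p.1 p.2
  exact h.comp ((hx.prodMk hb).prodMk hM)

end SigmaAlgebras

section Observations

variable {Ω S A : Type*} {mΩ : MeasurableSpace Ω} [MeasurableSpace S] [MeasurableSpace A]

/-- The indicator of the event that a random variable takes the value `x`. -/
noncomputable def eventEq {X : Type*} (Y : Ω → X) (x : X) (ω : Ω) : ℝ :=
  (Y ⁻¹' {x}).indicator (fun _ => 1) ω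

theorem eventEq_eq {X : Type*} (Y : Ω → X) (x : X) (ω : Ω) :
    eventEq Y x ω = 0 ∨ eventEq Y x ω = 1 := by
  by_cases h : ω ∈ Y ⁻¹' {x}
  · exact Or.inr (Set.indicator_of_mem h _)
  · exact Or.inl (Set.indicator_of_notMem h _)

theorem eventEq_self {X : Type*} {Y : Ω → X} {x : X} {ω : Ω} (h : Y ω = x) :
    eventEq Y x ω = 1 :=
  Set.indicator_of_mem (show ω ∈ Y ⁻¹' {x} from h) _

theorem eventEq_ne {X : Type*} {Y : Ω → X} {x : X} {ω : Ω} (h : Y ω ≠ x) :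
    eventEq Y x ω = 0 :=
  Set.indicator_of_notMem (show ω ∉ Y ⁻¹' {x} from h) _

theorem eventEq_mem {X : Type*} (Y : Ω → X) (x : X) (ω : Ω) :
    eventEq Y x ω ∈ Set.Icc (0 : ℝ) 1 := by
  rcases eventEq_eq Y x ω with h | h <;> simp [h]

theorem measurable_eventEq {X : Type*} [MeasurableSpace X] [MeasurableSingletonClass X]
    {m : MeasurableSpace Ω} {Y : Ω → X} (hY : Measurable Y) (x : X) :
    Measurable (eventEq Y x) :=
  measurable_const.indicator (hY (measurableSet_singleton x))

theorem sum_eventEq_mul {X : Type*} [Fintype X] (Y : Ω → X) (F : X → ℝ) (ω : Ω) :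
    ∑ x, eventEq Y x ω * F x = F (Y ω) := by
  rw [Finset.sum_eq_single (Y ω)]
  · rw [eventEq_self rfl, one_mul]
  · intro x _ hx
    rw [eventEq_ne hx.symm, zero_mul]
  · simp

/-- The indicator of the beginning of an episode. -/
noncomputable def initObs (Ω : Type*) (τ u : ℕ) (_ : Ω) : ℝ := if u % τ = 0 then 1 else 0

/-- The indicator of the event that `b` is selected in state `x` at time `u`. -/
noncomputable def rewardObs (s : ℕ → Ω → S) (a : ℕ → Ω → A) (x : S) (b : A) (u : ℕ) : Ω → ℝ :=
  eventEq (fun ω => (s u ω, a u ω)) (x, b)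

/-- The indicator of the event that `b` is selected in state `x` at time `u`, and that this is not
the last step of an episode. -/
noncomputable def transObs (τ : ℕ) (s : ℕ → Ω → S) (a : ℕ → Ω → A) (x : S) (b : A) (u : ℕ)
    (ω : Ω) : ℝ :=
  if u % τ + 1 < τ then rewardObs s a x b u ω else 0

variable {P : Measure Ω} {τ : ℕ} {f : Measure (MDP S A)} {opt : MDP S A → Policy S A τ}
  {Mstar : Ω → MDP S A} {Msamp : ℕ → Ω → MDP S A}
  {s : ℕ → Ω → S} {a : ℕ → Ω → A} {r : ℕ → Ω → unitInterval}

theorem IsPSRL.pastSigma_le (h : IsPSRL P τ f opt Mstar Msamp s a r) (k t : ℕ) :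
    pastSigma Mstar Msamp s a r k t ≤ mΩ :=
  measurable_iff_comap_le.1 (h.measurable_Mstar.prodMk
    ((measurable_pi_lambda _ fun e : Fin k => h.measurable_Msamp e).prodMk
      (measurable_pi_lambda _ fun u : Fin t => (h.measurable_s u).prodMk
        ((h.measurable_a u).prodMk (h.measurable_r u)))))

theorem IsPSRL.identDistrib [IsProbabilityMeasure P] (h : IsPSRL P τ f opt Mstar Msamp s a r)
    (k : ℕ) {F : Type*} [MeasurableSpace F] (W : Ω → F)
    (hW : Measurable[historySigma s a r (k * τ)] W) :
    IdentDistrib (fun ω => (Msamp k ω, W ω)) (fun ω => (Mstar ω, W ω)) P P :=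
  identDistrib_prodMk_of_condExp_eq (h.pastSigma_le k (k * τ))
    (historySigma_le_pastSigma k (k * τ)) (h.measurable_Msamp k) h.measurable_Mstar hW (h.sample k)

variable [Fintype S] [DiscreteMeasurableSpace S]

theorem IsPSRL.isObservation_init [IsProbabilityMeasure P]
    (h : IsPSRL P τ f opt Mstar Msamp s a r) (x : S) :
    IsObservation P τ (historySigma s a r) (fun ω => (Mstar ω).initProb x)
      (initObs Ω τ) (fun u => eventEq (s u) x) where
  measurable_param := (MDP.measurable_initProb x).comp h.measurable_Mstar
  param_mem ω := ⟨(Mstar ω).initProb_nonneg x, (Mstar ω).initProb_le_one x⟩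
  measurable_I u := measurable_const
  measurable_Y u := measurable_eventEq (h.measurable_s u) x
  I_eq u ω := by unfold initObs; split_ifs <;> simp
  Y_mem u ω := eventEq_mem _ _ _
  history_I k u hu := measurable_const
  history_mul k u hu := measurable_const.mul (measurable_eventEq (measurable_state hu) x)
  unbiased u := by
    by_cases hu : u % τ = 0
    · obtain ⟨k, rfl⟩ : ∃ k, u = k * τ := ⟨u / τ, by
        have := Nat.div_add_mod' u τ
        omega⟩
      have hle := historySigma_le_pastSigma (Mstar := Mstar) (Msamp := Msamp)
        (s := s) (a := a) (r := r) (k + 1) (k * τ)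
      refine ⟨_, h.pastSigma_le (k + 1) (k * τ), fun v _ => measurable_const, fun v hv => ?_,
        (MDP.measurable_initProb x).comp (measurable_past_Mstar _ _), ?_⟩
      · exact measurable_const.mul
          (measurable_eventEq ((measurable_state hv).mono hle le_rfl) x)
      · simp only [initObs, hu, if_true, one_mul]
        exact h.initial k x
    · refine ⟨mΩ, le_rfl, fun v _ => measurable_const, fun v _ => ?_,
        (MDP.measurable_initProb x).comp h.measurable_Mstar, ?_⟩
      · exact measurable_const.mul (measurable_eventEq (h.measurable_s v) x)
      · simp only [initObs, hu, if_false, zero_mul]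
        exact (condExp_zero).eventuallyEq

variable [Fintype A] [DiscreteMeasurableSpace A]

theorem measurable_rewardObs {m : MeasurableSpace Ω} {u : ℕ} (hs : Measurable (s u))
    (ha : Measurable (a u)) (x : S) (b : A) : Measurable (rewardObs s a x b u) :=
  measurable_eventEq (hs.prodMk ha) _

theorem measurable_transObs {m : MeasurableSpace Ω} {u : ℕ} (hs : Measurable (s u))
    (ha : Measurable (a u)) (x : S) (b : A) : Measurable (transObs τ s a x b u) := by
  unfold transObs
  split_ifs
  · exact measurable_rewardObs hs ha x b
  · exact measurable_const

theorem IsPSRL.isObservation_reward [IsProbabilityMeasure P] (hτ : 0 < τ)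
    (h : IsPSRL P τ f opt Mstar Msamp s a r) (x : S) (b : A) :
    IsObservation P τ (historySigma s a r) (fun ω => (Mstar ω).meanReward x b)
      (rewardObs s a x b) (fun u ω => (r u ω : ℝ)) where
  measurable_param := (MDP.measurable_meanReward x b).comp h.measurable_Mstar
  param_mem ω := ⟨(Mstar ω).meanReward_nonneg x b, (Mstar ω).meanReward_le_one x b⟩
  measurable_I u := measurable_rewardObs (h.measurable_s u) (h.measurable_a u) x b
  measurable_Y u := measurable_subtype_coe.comp (h.measurable_r u)
  I_eq u ω := eventEq_eq _ _ _
  Y_mem u ω := (r u ω).2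
  history_I k u hu := measurable_rewardObs (measurable_state hu) (measurable_action hu) x b
  history_mul k u hu := (measurable_rewardObs (measurable_state hu) (measurable_action hu) x b).mul
    (measurable_subtype_coe.comp (measurable_reward hu))
  unbiased u := by
    obtain ⟨k, j, rfl⟩ : ∃ (k : ℕ) (j : Fin τ), u = k * τ + j :=
      ⟨u / τ, ⟨u % τ, Nat.mod_lt u hτ⟩, (Nat.div_add_mod' u τ).symm⟩
    set t := k * τ + j with ht
    have hsa : Measurable fun ω => (s t ω, a t ω) := (h.measurable_s t).prodMk (h.measurable_a t)
    have hint : Integrable (fun ω => (r t ω : ℝ)) P :=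
      Integrable.of_mem_Icc 0 1 (measurable_subtype_coe.comp (h.measurable_r t)).aemeasurable
        (ae_of_all _ fun ω => (r t ω).2)
    have hr : Measurable (r t) := h.measurable_r t
    have hreward := h.reward k j
    set m := pastSigma Mstar Msamp s a r (k + 1) t ⊔
      MeasurableSpace.comap (fun ω => (s t ω, a t ω)) inferInstance with hm
    have hmle : m ≤ mΩ := sup_le (h.pastSigma_le _ _) (measurable_iff_comap_le.1 hsa)
    have hpm : pastSigma Mstar Msamp s a r (k + 1) t ≤ m := le_sup_left
    have hhm : historySigma s a r t ≤ m := (historySigma_le_pastSigma _ _).trans hpm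
    have hMm : Measurable[m] Mstar := (measurable_past_Mstar _ _).mono hpm le_rfl
    have hsam : Measurable[m] fun ω => (s t ω, a t ω) :=
      (comap_measurable fun ω => (s t ω, a t ω)).mono le_sup_right le_rfl
    have hIm : Measurable[m] (rewardObs s a x b t) :=
      measurable_rewardObs (measurable_fst.comp hsam) (measurable_snd.comp hsam) x b
    have hκ : Measurable[m] fun ω =>
        ((Mstar ω).reward (s t ω) (a t ω) : Measure unitInterval) :=
      measurable_comp_state_action (fun x b M => (M.reward x b : Measure unitInterval))
        MDP.measurable_reward (measurable_fst.comp hsam) (measurable_snd.comp hsam) hMm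
    have hmean := condExp_unitInterval_eq_integral hmle hr hκ
      (fun ω => inferInstance) hreward
    have hIb : ∀ ω, |rewardObs s a x b t ω| ≤ 1 := fun ω => by
      rcases eventEq_eq (fun ω => (s t ω, a t ω)) (x, b) ω with h | h <;> simp [rewardObs, h]
    refine ⟨m, hmle, fun v hv => ?_, fun v hv => ?_,
      (MDP.measurable_meanReward x b).comp hMm, ?_⟩
    · exact (measurable_rewardObs (measurable_state hv) (measurable_action hv) x b).mono hhm le_rfl
    · exact ((measurable_rewardObs (measurable_state hv) (measurable_action hv) x b).mul
        (measurable_subtype_coe.comp (measurable_reward hv))).mono hhm le_rfl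
    · refine (condExp_mul_eq hmle hint hmean hIm 1 hIb).trans (ae_of_all _ fun ω => ?_)
      by_cases hω : (s t ω, a t ω) = (x, b)
      · simp only [Prod.mk.injEq] at hω
        simp only [hω, MDP.meanReward]
      · simp only [rewardObs, eventEq_ne (Y := fun ω => (s t ω, a t ω)) hω, zero_mul]

theorem IsPSRL.isObservation_trans [IsProbabilityMeasure P] (hτ : 0 < τ)
    (h : IsPSRL P τ f opt Mstar Msamp s a r) (x : S) (b : A) (y : S) :
    IsObservation P τ (historySigma s a r) (fun ω => (Mstar ω).transProb x b y)
      (transObs τ s a x b) (fun u => eventEq (s (u + 1)) y) where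
  measurable_param := (MDP.measurable_transProb x b y).comp h.measurable_Mstar
  param_mem ω := ⟨(Mstar ω).transProb_nonneg x b y, (Mstar ω).transProb_le_one x b y⟩
  measurable_I u := measurable_transObs (h.measurable_s u) (h.measurable_a u) x b
  measurable_Y u := measurable_eventEq (h.measurable_s (u + 1)) y
  I_eq u ω := by
    unfold transObs
    split_ifs
    · exact eventEq_eq _ _ _
    · exact Or.inl rfl
  Y_mem u ω := eventEq_mem _ _ _
  history_I k u hu := measurable_transObs (measurable_state hu) (measurable_action hu) x b
  history_mul k u hu := by
    by_cases hj : u % τ + 1 < τ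
    · have hu' : u + 1 < k * τ := by
        have h1 : u / τ + 1 ≤ k := (Nat.div_lt_iff_lt_mul hτ).2 hu
        have h2 := Nat.mul_le_mul_right τ h1
        have h3 := Nat.div_add_mod' u τ
        rw [add_mul] at h2
        omega
      exact (measurable_transObs (measurable_state hu) (measurable_action hu) x b).mul
        (measurable_eventEq (measurable_state hu') y)
    · simp only [transObs, hj, if_false, zero_mul]
      exact measurable_const
  unbiased u := by
    by_cases hj : u % τ + 1 < τ
    · obtain ⟨k, j, hj', rfl⟩ : ∃ k j : ℕ, j + 1 < τ ∧ u = k * τ + j :=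
        ⟨u / τ, u % τ, hj, (Nat.div_add_mod' u τ).symm⟩
      set t := k * τ + j with ht
      have hint : Integrable (eventEq (s (t + 1)) y) P :=
        Integrable.of_mem_Icc 0 1 (measurable_eventEq (h.measurable_s (t + 1)) y).aemeasurable
          (ae_of_all _ fun ω => eventEq_mem _ _ _)
      have htrans := h.transition k j hj' y
      set m := pastSigma Mstar Msamp s a r (k + 1) (t + 1) with hm
      have hmle : m ≤ mΩ := h.pastSigma_le _ _
      have hhm : historySigma s a r (t + 1) ≤ m := historySigma_le_pastSigma _ _
      have hs : ∀ v < t + 1, Measurable[m] (s v) := fun v hv =>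
        (measurable_state hv).mono hhm le_rfl
      have ha : ∀ v < t + 1, Measurable[m] (a v) := fun v hv =>
        (measurable_action hv).mono hhm le_rfl
      have hMm : Measurable[m] Mstar := measurable_past_Mstar _ _
      have hIm : Measurable[m] (transObs τ s a x b t) :=
        measurable_transObs (hs t (by omega)) (ha t (by omega)) x b
      have hIb : ∀ ω, |transObs τ s a x b t ω| ≤ 1 := fun ω => by
        rw [transObs, if_pos hj]
        rcases eventEq_eq (fun ω => (s t ω, a t ω)) (x, b) ω with h | h <;> simp [rewardObs, h]
      refine ⟨m, hmle, fun v hv => measurable_transObs (hs v (by omega)) (ha v (by omega)) x b,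
        fun v hv => ?_, (MDP.measurable_transProb x b y).comp hMm, ?_⟩
      · exact (measurable_transObs (hs v (by omega)) (ha v (by omega)) x b).mul
          (measurable_eventEq (hs (v + 1) (by omega)) y)
      · refine (condExp_mul_eq hmle hint htrans hIm 1 hIb).trans
          (ae_of_all _ fun ω => ?_)
        by_cases hω : (s t ω, a t ω) = (x, b)
        · simp only [Prod.mk.injEq] at hω
          simp only [← ht, hω, MDP.transProb]
        · simp only [transObs, rewardObs, eventEq_ne (Y := fun ω => (s t ω, a t ω)) hω, ite_self,
            zero_mul]
    · have hs : ∀ v, Measurable (transObs τ s a x b v) := fun v =>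
        measurable_transObs (h.measurable_s v) (h.measurable_a v) x b
      refine ⟨mΩ, le_rfl, fun v _ => hs v, fun v _ =>
        (hs v).mul (measurable_eventEq (h.measurable_s (v + 1)) y),
        (MDP.measurable_transProb x b y).comp h.measurable_Mstar, ?_⟩
      simp only [transObs, hj, if_false, zero_mul]
      exact (condExp_zero).eventuallyEq

end Observations

section ValueDifference

theorem sum_sub_mul_le {S : Type*} [Fintype S] {p q v : S → ℝ} {c : ℝ}
    (hv0 : ∀ y, 0 ≤ v y) (hv : ∀ y, v y ≤ c) :
    ∑ y, (p y - q y) * v y ≤ c * ∑ y, |p y - q y| := by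
  rw [Finset.mul_sum]
  refine Finset.sum_le_sum fun y _ => ?_
  calc (p y - q y) * v y ≤ |p y - q y| * v y := mul_le_mul_of_nonneg_right (le_abs_self _) (hv0 y)
    _ ≤ |p y - q y| * c := mul_le_mul_of_nonneg_left (hv y) (abs_nonneg _)
    _ = c * |p y - q y| := mul_comm _ _

variable {S A : Type*} [MeasurableSpace S] [Fintype S] [Nonempty A] {τ : ℕ}

theorem MDP.value_sub_value_le_of_last (M M' : MDP S A) (μ : Policy S A τ) (i : Fin τ)
    (h : i + 1 = τ) (x : S) :
    M.value μ i x - M'.value μ i x ≤ |M.meanReward x (μ i x) - M'.meanReward x (μ i x)| := by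
  rw [M.value_of_add_one_eq μ i h, M'.value_of_add_one_eq μ i h]
  exact le_abs_self _

variable [DiscreteMeasurableSpace S]

theorem MDP.value_sub_value_le (M M' : MDP S A) (μ : Policy S A τ) (i : Fin τ) (h : i + 1 < τ)
    (x : S) :
    M.value μ i x - M'.value μ i x ≤ |M.meanReward x (μ i x) - M'.meanReward x (μ i x)| +
      τ * ∑ y, |M.transProb x (μ i x) y - M'.transProb x (μ i x) y| +
      ∑ y, M'.transProb x (μ i x) y *
        (M.value μ ⟨i + 1, h⟩ y - M'.value μ ⟨i + 1, h⟩ y) := by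
  rw [M.value_of_add_one_lt μ i h, M'.value_of_add_one_lt μ i h]
  have h1 := sum_sub_mul_le (p := M.transProb x (μ i x)) (q := M'.transProb x (μ i x))
    (M.value_nonneg μ ⟨i + 1, h⟩) (M.value_le μ ⟨i + 1, h⟩)
  have h2 := le_abs_self (M.meanReward x (μ i x) - M'.meanReward x (μ i x))
  simp only [sub_mul, mul_sub, Finset.sum_sub_distrib] at h1 ⊢
  linarith

theorem MDP.abs_value_sub_value_le (M M' : MDP S A) (μ μ' : Policy S A τ) (i : Fin τ) (x : S) :
    |M.value μ i x - M'.value μ' i x| ≤ τ := by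
  have h1 := M.value_nonneg μ i x
  have h2 := M.value_le μ i x
  have h3 := M'.value_nonneg μ' i x
  have h4 := M'.value_le μ' i x
  exact abs_le.2 ⟨by linarith, by linarith⟩

end ValueDifference

section Regret

variable {Ω S A : Type*} {m mΩ : MeasurableSpace Ω} [MeasurableSpace S]
  {P : Measure Ω} {τ : ℕ} {opt : MDP S A → Policy S A τ}
  {Mstar : Ω → MDP S A} {Msamp : ℕ → Ω → MDP S A}
  {s : ℕ → Ω → S} {a : ℕ → Ω → A} {r : ℕ → Ω → unitInterval}

/-- The differences between the mean rewards and the transition probabilities of the sampled and of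
the true MDP in the state and for the action at time `u`. -/
noncomputable def stepError [Fintype S] [Fintype A] (τ : ℕ) (Mstar : Ω → MDP S A)
    (Msamp : ℕ → Ω → MDP S A) (s : ℕ → Ω → S) (a : ℕ → Ω → A) (u : ℕ) (ω : Ω) : ℝ :=
  (∑ p : S × A, rewardObs s a p.1 p.2 u ω *
    |(Msamp (u / τ) ω).meanReward p.1 p.2 - (Mstar ω).meanReward p.1 p.2|) +
  τ * ∑ p : S × A, ∑ y, transObs τ s a p.1 p.2 u ω *
    |(Msamp (u / τ) ω).transProb p.1 p.2 y - (Mstar ω).transProb p.1 p.2 y|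

theorem stepError_eq [Fintype S] [Fintype A] (u : ℕ) (ω : Ω) :
    stepError τ Mstar Msamp s a u ω =
      |(Msamp (u / τ) ω).meanReward (s u ω) (a u ω) - (Mstar ω).meanReward (s u ω) (a u ω)| +
      if u % τ + 1 < τ then
        τ * ∑ y, |(Msamp (u / τ) ω).transProb (s u ω) (a u ω) y -
          (Mstar ω).transProb (s u ω) (a u ω) y| else 0 := by
  have h1 := fun F => sum_eventEq_mul (fun ω => (s u ω, a u ω)) F ω
  unfold stepError transObs rewardObs
  rw [h1 fun p => |(Msamp (u / τ) ω).meanReward p.1 p.2 - (Mstar ω).meanReward p.1 p.2|]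
  split_ifs
  · simp_rw [← Finset.mul_sum]
    rw [h1 fun p => ∑ y, |(Msamp (u / τ) ω).transProb p.1 p.2 y - (Mstar ω).transProb p.1 p.2 y|]
  · simp

theorem abs_sub_le_one {x y : ℝ} (hx : x ∈ Set.Icc (0 : ℝ) 1) (hy : y ∈ Set.Icc (0 : ℝ) 1) :
    |x - y| ≤ 1 :=
  abs_le.2 ⟨by linarith [hx.1, hy.2], by linarith [hx.2, hy.1]⟩

theorem integrable_obs_mul_abs [IsProbabilityMeasure P] {ℱ : ℕ → MeasurableSpace Ω} {ϑ : Ω → ℝ}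
    {I Y : ℕ → Ω → ℝ} (h : IsObservation P τ ℱ ϑ I Y) {ϑ' : Ω → ℝ} (hm : Measurable ϑ')
    (h' : ∀ ω, ϑ' ω ∈ Set.Icc (0 : ℝ) 1) (u : ℕ) :
    Integrable (fun ω => I u ω * |ϑ' ω - ϑ ω|) P :=
  Integrable.of_mem_Icc 0 1 ((h.measurable_I u).mul
    (measurable_abs.comp (hm.sub h.measurable_param))).aemeasurable
    (ae_of_all _ fun ω => ⟨mul_nonneg (h.I_nonneg u ω) (abs_nonneg _),
      mul_le_one₀ (h.I_le_one u ω) (abs_nonneg _) (abs_sub_le_one (h' ω) (h.param_mem ω))⟩)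

/-- The difference, at step `i` of episode `k` and in state `x`, between the values of the policy
that is followed for the sampled MDP and for the true one. -/
noncomputable def valueGap [Fintype S] (opt : MDP S A → Policy S A τ) (Mstar : Ω → MDP S A)
    (Msamp : ℕ → Ω → MDP S A) (k : ℕ) (i : Fin τ) (x : S) (ω : Ω) : ℝ :=
  (Msamp k ω).value (opt (Msamp k ω)) i x - (Mstar ω).value (opt (Msamp k ω)) i x

theorem abs_valueGap_le [Fintype S] [DiscreteMeasurableSpace S] [Nonempty A] (k : ℕ) (i : Fin τ)
    (x : S) (ω : Ω) :
    |valueGap opt Mstar Msamp k i x ω| ≤ τ :=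
  MDP.abs_value_sub_value_le _ _ _ _ _ _

theorem valueGap_comp_eq [Fintype S] (k : ℕ) (i : Fin τ) (t : ℕ) (ω : Ω) :
    valueGap opt Mstar Msamp k i (s t ω) ω =
      ∑ y, valueGap opt Mstar Msamp k i y ω * eventEq (s t) y ω := by
  simp_rw [mul_comm (valueGap _ _ _ _ _ _ _)]
  rw [sum_eventEq_mul (s t) (fun y => valueGap opt Mstar Msamp k i y ω)]

variable [MeasurableSpace A] {f : Measure (MDP S A)} [IsProbabilityMeasure P]

theorem IsPSRL.integrable_initError [DiscreteMeasurableSpace S]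
    (h : IsPSRL P τ f opt Mstar Msamp s a r) (k : ℕ) (x : S) :
    Integrable (fun ω => |(Msamp k ω).initProb x - (Mstar ω).initProb x|) P :=
  Integrable.of_mem_Icc 0 1 (measurable_abs.comp
    (((MDP.measurable_initProb x).comp (h.measurable_Msamp k)).sub
      ((MDP.measurable_initProb x).comp h.measurable_Mstar))).aemeasurable
    (ae_of_all _ fun _ => ⟨abs_nonneg _, abs_sub_le_one
      ⟨MDP.initProb_nonneg _ _, MDP.initProb_le_one _ _⟩
      ⟨MDP.initProb_nonneg _ _, MDP.initProb_le_one _ _⟩⟩)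

variable [Fintype S] [DiscreteMeasurableSpace S] [Fintype A] [DiscreteMeasurableSpace A]

theorem measurable_valueGap {m : MeasurableSpace Ω} (hopt : Measurable opt) (k : ℕ)
    (h1 : Measurable[m] Mstar) (h2 : Measurable[m] (Msamp k)) (i : Fin τ) (x : S) :
    Measurable[m] (valueGap opt Mstar Msamp k i x) :=
  (MDP.measurable_value_policy h2 (hopt.comp h2) i x).sub
    (MDP.measurable_value_policy h1 (hopt.comp h2) i x)

theorem IsPSRL.integrable_rewardError (h : IsPSRL P τ f opt Mstar Msamp s a r) (hτ : 0 < τ)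
    (u : ℕ) (x : S) (b : A) :
    Integrable (fun ω => rewardObs s a x b u ω *
      |(Msamp (u / τ) ω).meanReward x b - (Mstar ω).meanReward x b|) P :=
  integrable_obs_mul_abs (h.isObservation_reward hτ x b)
    ((MDP.measurable_meanReward x b).comp (h.measurable_Msamp _))
    (fun _ => ⟨MDP.meanReward_nonneg _ _ _, MDP.meanReward_le_one _ _ _⟩) u

theorem IsPSRL.integrable_transError (h : IsPSRL P τ f opt Mstar Msamp s a r) (hτ : 0 < τ)
    (u : ℕ) (x : S) (b : A) (y : S) :
    Integrable (fun ω => transObs τ s a x b u ω *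
      |(Msamp (u / τ) ω).transProb x b y - (Mstar ω).transProb x b y|) P :=
  integrable_obs_mul_abs (h.isObservation_trans hτ x b y)
    ((MDP.measurable_transProb x b y).comp (h.measurable_Msamp _))
    (fun _ => ⟨MDP.transProb_nonneg _ _ _ _, MDP.transProb_le_one _ _ _ _⟩) u

theorem IsPSRL.integrable_stepError (h : IsPSRL P τ f opt Mstar Msamp s a r) (hτ : 0 < τ)
    (u : ℕ) : Integrable (stepError τ Mstar Msamp s a u) P :=
  (integrable_finsetSum _ fun p _ => h.integrable_rewardError hτ u p.1 p.2).add
    ((integrable_finsetSum _ fun p _ => integrable_finsetSum _ fun y _ =>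
      h.integrable_transError hτ u p.1 p.2 y).const_mul _)

theorem IsPSRL.integral_stepError (h : IsPSRL P τ f opt Mstar Msamp s a r) (hτ : 0 < τ) (u : ℕ) :
    ∫ ω, stepError τ Mstar Msamp s a u ω ∂P =
      (∑ p : S × A, ∫ ω, rewardObs s a p.1 p.2 u ω *
        |(Msamp (u / τ) ω).meanReward p.1 p.2 - (Mstar ω).meanReward p.1 p.2| ∂P) +
      τ * ∑ p : S × A, ∑ y, ∫ ω, transObs τ s a p.1 p.2 u ω *
        |(Msamp (u / τ) ω).transProb p.1 p.2 y - (Mstar ω).transProb p.1 p.2 y| ∂P := by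
  have h1 := fun (p : S × A) => h.integrable_rewardError hτ u p.1 p.2
  have h2 := fun (p : S × A) y => h.integrable_transError hτ u p.1 p.2 y
  have h3 := fun (p : S × A) => integrable_finsetSum Finset.univ fun y _ => h2 p y
  unfold stepError
  rw [integral_add (integrable_finsetSum _ fun p _ => h1 p)
    ((integrable_finsetSum _ fun p _ => h3 p).const_mul _), integral_const_mul,
    integral_finsetSum _ fun p _ => h1 p, integral_finsetSum _ fun p _ => h3 p]
  simp_rw [integral_finsetSum _ fun y _ => h2 _ y]

variable [Nonempty A]

theorem integrable_mul_valueGap (hopt : Measurable opt) (h1 : Measurable Mstar)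
    (h2 : ∀ k, Measurable (Msamp k)) {Y : Ω → ℝ} (hY : Measurable Y)
    (hY1 : ∀ ω, Y ω ∈ Set.Icc (0 : ℝ) 1) (k : ℕ) (i : Fin τ) (x : S) :
    Integrable (fun ω => valueGap opt Mstar Msamp k i x ω * Y ω) P := by
  refine Integrable.of_bound
    ((measurable_valueGap hopt k h1 (h2 k) i x).mul hY).aestronglyMeasurable (τ : ℝ)
    (ae_of_all _ fun ω => ?_)
  rw [Real.norm_eq_abs, abs_mul, abs_of_nonneg (hY1 ω).1]
  exact (mul_le_of_le_one_right (abs_nonneg _) (hY1 ω).2).trans (abs_valueGap_le _ _ _ _)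

theorem IsPSRL.integrable_valueGap_comp (h : IsPSRL P τ f opt Mstar Msamp s a r)
    (hopt : Measurable opt) (k : ℕ) (i : Fin τ) (t : ℕ) :
    Integrable (fun ω => valueGap opt Mstar Msamp k i (s t ω) ω) P := by
  simp_rw [valueGap_comp_eq]
  exact integrable_finsetSum _ fun y _ => integrable_mul_valueGap hopt h.measurable_Mstar
    h.measurable_Msamp (measurable_eventEq (h.measurable_s t) y) (eventEq_mem _ _) k i y

theorem IsPSRL.integral_valueGap_comp (h : IsPSRL P τ f opt Mstar Msamp s a r)
    (hopt : Measurable opt) (k : ℕ) (i : Fin τ) (t : ℕ) (hm : m ≤ mΩ)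
    (h1 : Measurable[m] Mstar) (h2 : Measurable[m] (Msamp k)) {q : S → Ω → ℝ}
    (hq : ∀ y, P⟦s t ⁻¹' {y} | m⟧ =ᵐ[P] q y) :
    ∫ ω, valueGap opt Mstar Msamp k i (s t ω) ω ∂P =
      ∑ y, ∫ ω, valueGap opt Mstar Msamp k i y ω * q y ω ∂P := by
  have hs := fun y => measurable_eventEq (h.measurable_s t) y
  have hi := fun y => integrable_mul_valueGap (P := P) hopt h.measurable_Mstar
    h.measurable_Msamp (hs y) (eventEq_mem _ _) k i y
  simp_rw [valueGap_comp_eq]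
  rw [integral_finsetSum _ fun y _ => hi y]
  refine Finset.sum_congr rfl fun y _ => ?_
  refine integral_mul_eq_of_condExp_eq hm ?_ (hq y) (measurable_valueGap hopt k h1 h2 i y) τ
    (abs_valueGap_le k i y)
  exact Integrable.of_mem_Icc 0 1 (hs y).aemeasurable (ae_of_all _ (eventEq_mem _ _))

theorem IsPSRL.integral_valueGap_le_of_last (h : IsPSRL P τ f opt Mstar Msamp s a r)
    (hopt : Measurable opt) (k : ℕ) (i : Fin τ) (hi : i + 1 = τ) :
    ∫ ω, valueGap opt Mstar Msamp k i (s (k * τ + i) ω) ω ∂P ≤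
      ∫ ω, stepError τ Mstar Msamp s a (k * τ + i) ω ∂P := by
  have hτ : 0 < τ := i.pos
  refine integral_mono_ae (h.integrable_valueGap_comp hopt k i _) (h.integrable_stepError hτ _) ?_
  filter_upwards [h.action k i] with ω hω
  have hd : (k * τ + i) / τ = k := by
    rw [mul_comm, Nat.mul_add_div hτ, Nat.div_eq_of_lt i.2, add_zero]
  have hmod : (k * τ + i) % τ = i := by
    rw [mul_comm, Nat.mul_add_mod, Nat.mod_eq_of_lt i.2]
  rw [stepError_eq, hd, hmod, hω, if_neg (by omega), add_zero]
  exact MDP.value_sub_value_le_of_last _ _ _ i hi _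

theorem IsPSRL.integral_valueGap_le (h : IsPSRL P τ f opt Mstar Msamp s a r)
    (hopt : Measurable opt) (k : ℕ) (i : Fin τ) (hi : i + 1 < τ) :
    ∫ ω, valueGap opt Mstar Msamp k i (s (k * τ + i) ω) ω ∂P ≤
      ∫ ω, stepError τ Mstar Msamp s a (k * τ + i) ω ∂P +
      ∫ ω, valueGap opt Mstar Msamp k ⟨i + 1, hi⟩ (s (k * τ + i + 1) ω) ω ∂P := by
  have hτ : 0 < τ := i.pos
  set t := k * τ + (i : ℕ) with ht
  have hq : ∀ y, Measurable fun ω => (Mstar ω).transProb (s t ω) (a t ω) y := fun y =>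
    measurable_comp_state_action (fun x b M => M.transProb x b y)
      (fun x b => MDP.measurable_transProb x b y) (h.measurable_s t) (h.measurable_a t)
      h.measurable_Mstar
  have hint := fun y => integrable_mul_valueGap (P := P) hopt h.measurable_Mstar
    h.measurable_Msamp (hq y) (fun _ => ⟨MDP.transProb_nonneg _ _ _ _,
      MDP.transProb_le_one _ _ _ _⟩) k ⟨i + 1, hi⟩ y
  rw [h.integral_valueGap_comp hopt k ⟨i + 1, hi⟩ (t + 1) (h.pastSigma_le (k + 1) (t + 1))
    (measurable_past_Mstar _ _) (measurable_past_Msamp (Nat.lt_succ_self k) _)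
    (q := fun y ω => (Mstar ω).transProb (s t ω) (a t ω) y) (fun y => h.transition k i hi y),
    ← integral_finsetSum _ fun y _ => hint y,
    ← integral_add (h.integrable_stepError hτ _) (integrable_finsetSum _ fun y _ => hint y)]
  refine integral_mono_ae (h.integrable_valueGap_comp hopt k i _)
    ((h.integrable_stepError hτ _).add (integrable_finsetSum _ fun y _ => hint y)) ?_
  filter_upwards [h.action k i] with ω hω
  have hd : t / τ = k := by
    rw [ht, mul_comm, Nat.mul_add_div hτ, Nat.div_eq_of_lt i.2, add_zero]
  have hmod : t % τ = i := by
    rw [ht, mul_comm, Nat.mul_add_mod, Nat.mod_eq_of_lt i.2]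
  rw [← ht] at hω
  rw [stepError_eq, hd, hmod, hω, if_pos hi]
  simp_rw [mul_comm (valueGap _ _ _ _ _ _ _)]
  exact MDP.value_sub_value_le _ _ _ i hi _

theorem IsPSRL.integral_valueGap_le_sum (h : IsPSRL P τ f opt Mstar Msamp s a r)
    (hopt : Measurable opt) (k n : ℕ) (i : Fin τ) (hi : i + n = τ) :
    ∫ ω, valueGap opt Mstar Msamp k i (s (k * τ + i) ω) ω ∂P ≤
      ∑ j ∈ Finset.range n, ∫ ω, stepError τ Mstar Msamp s a (k * τ + i + j) ω ∂P := by
  induction n generalizing i with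
  | zero => exact absurd i.2 (by omega)
  | succ n ih =>
    rw [Finset.sum_range_succ', add_zero]
    rcases Nat.eq_zero_or_pos n with rfl | hn
    · simpa using h.integral_valueGap_le_of_last hopt k i hi
    · have h1 := h.integral_valueGap_le hopt k i (by omega)
      have h2 := ih ⟨i + 1, by omega⟩ (by simp only; omega)
      simp only [← add_assoc] at h2
      have e : ∀ j, k * τ + (i : ℕ) + 1 + j = k * τ + i + (j + 1) := fun j => by omega
      simp only [e] at h2
      linarith

theorem IsPSRL.integral_episodeRegret_le [NeZero τ] (h : IsPSRL P τ f opt Mstar Msamp s a r)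
    (hopt : Measurable opt) (k : ℕ) :
    Integrable (fun ω => episodeRegret opt (Mstar ω) (Msamp k ω)) P ∧
    ∫ ω, episodeRegret opt (Mstar ω) (Msamp k ω) ∂P ≤
      τ * ∑ x, ∫ ω, |(Msamp k ω).initProb x - (Mstar ω).initProb x| ∂P +
      ∑ j ∈ Finset.range τ, ∫ ω, stepError τ Mstar Msamp s a (k * τ + j) ω ∂P := by
  set g : MDP S A → ℝ := fun M => ∑ x, M.initProb x * M.value (opt M) 0 x with hg
  have hgm : Measurable g := Finset.measurable_sum _ fun x _ => (MDP.measurable_initProb x).mul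
    (MDP.measurable_value_policy measurable_id hopt 0 x)
  have hmul : ∀ (M M' N : MDP S A) x, M.initProb x * M'.value (opt N) 0 x ∈ Set.Icc (0 : ℝ) τ :=
    fun M M' N x => ⟨mul_nonneg (M.initProb_nonneg x) (M'.value_nonneg _ _ _),
      (mul_le_of_le_one_left (M'.value_nonneg _ _ _) (M.initProb_le_one x)).trans
        (M'.value_le _ _ _)⟩
  have hgi : ∀ M : Ω → MDP S A, Measurable M → Integrable (fun ω => g (M ω)) P := fun M hM =>
    integrable_finsetSum _ fun x _ => Integrable.of_mem_Icc 0 τ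
      (((MDP.measurable_initProb x).comp hM).mul (MDP.measurable_value_policy hM
        (hopt.comp hM) 0 x)).aemeasurable (ae_of_all _ fun ω => hmul _ _ _ x)
  have hli : Integrable (fun ω => ∑ x, (Mstar ω).initProb x *
      (Mstar ω).value (opt (Msamp k ω)) 0 x) P :=
    integrable_finsetSum _ fun x _ => Integrable.of_mem_Icc 0 τ
      (((MDP.measurable_initProb x).comp h.measurable_Mstar).mul
        (MDP.measurable_value_policy h.measurable_Mstar
          (hopt.comp (h.measurable_Msamp k)) 0 x)).aemeasurable (ae_of_all _ fun ω => hmul _ _ _ x)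
  have hr : ∀ ω, episodeRegret opt (Mstar ω) (Msamp k ω) = g (Mstar ω) -
      ∑ x, (Mstar ω).initProb x * (Mstar ω).value (opt (Msamp k ω)) 0 x := fun ω => by
    simp only [episodeRegret, hg, ← Finset.sum_sub_distrib, ← mul_sub]
    rfl
  have hge : ∫ ω, g (Msamp k ω) ∂P = ∫ ω, g (Mstar ω) ∂P :=
    ((h.identDistrib k (fun _ => ()) measurable_const).comp
      (u := fun p : MDP S A × Unit => g p.1) (hgm.comp measurable_fst)).integral_eq
  simp_rw [hr]
  refine ⟨(hgi _ h.measurable_Mstar).sub hli, ?_⟩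
  rw [integral_sub (hgi _ h.measurable_Mstar) hli, ← hge,
    ← integral_sub (hgi _ (h.measurable_Msamp k)) hli]
  have hρ : ∀ x, Integrable (fun ω => valueGap opt Mstar Msamp k 0 x ω * (Mstar ω).initProb x) P :=
    fun x => integrable_mul_valueGap (P := P) hopt h.measurable_Mstar h.measurable_Msamp
    ((MDP.measurable_initProb x).comp h.measurable_Mstar) (fun _ => ⟨MDP.initProb_nonneg _ _,
      MDP.initProb_le_one _ _⟩) k 0 x
  have hie := fun x => h.integrable_initError k x
  have hb := h.integral_valueGap_le_sum hopt k τ 0 (by simp)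
  simp only [Fin.val_zero, add_zero] at hb
  rw [h.integral_valueGap_comp hopt k 0 _ (h.pastSigma_le (k + 1) (k * τ))
    (measurable_past_Mstar _ _) (measurable_past_Msamp (Nat.lt_succ_self k) _)
    (q := fun x ω => (Mstar ω).initProb x) (fun x => h.initial k x)] at hb
  have hpt : ∀ ω, g (Msamp k ω) -
      ∑ x, (Mstar ω).initProb x * (Mstar ω).value (opt (Msamp k ω)) 0 x ≤
      τ * ∑ x, |(Msamp k ω).initProb x - (Mstar ω).initProb x| +
      ∑ x, valueGap opt Mstar Msamp k 0 x ω * (Mstar ω).initProb x := fun ω => by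
    have h1 := sum_sub_mul_le (p := (Msamp k ω).initProb) (q := (Mstar ω).initProb)
      ((Msamp k ω).value_nonneg (opt (Msamp k ω)) 0) ((Msamp k ω).value_le (opt (Msamp k ω)) 0)
    simp_rw [mul_comm (valueGap _ _ _ _ _ _ _)]
    simp only [hg, valueGap, sub_mul, mul_sub, Finset.sum_sub_distrib] at h1 ⊢
    linarith
  have hI1 : Integrable (fun ω => τ * ∑ x, |(Msamp k ω).initProb x - (Mstar ω).initProb x|) P :=
    (integrable_finsetSum _ fun x _ => hie x).const_mul _
  have hI2 : Integrable (fun ω => ∑ x, valueGap opt Mstar Msamp k 0 x ω * (Mstar ω).initProb x) P :=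
    integrable_finsetSum _ fun x _ => hρ x
  have := integral_mono ((hgi _ (h.measurable_Msamp k)).sub hli) (hI1.add hI2) hpt
  simp only [Pi.add_apply, Pi.sub_apply] at this
  refine this.trans ?_
  rw [integral_add hI1 hI2, integral_const_mul, integral_finsetSum _ fun x _ => hie x,
    integral_finsetSum _ fun x _ => hρ x]
  gcongr

theorem sum_range_mul (F : ℕ → ℝ) (K τ : ℕ) :
    ∑ k ∈ Finset.range K, ∑ j ∈ Finset.range τ, F (k * τ + j) =
      ∑ u ∈ Finset.range (K * τ), F u := by
  induction K with
  | zero => simp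
  | succ K ih => rw [Finset.sum_range_succ, ih, add_mul, one_mul, Finset.sum_range_add]

/-- Bayesian regret bound of posterior sampling. -/
theorem IsPSRL.integral_sum_episodeRegret_le [NeZero τ]
    (h : IsPSRL P τ f opt Mstar Msamp s a r) (hopt : Measurable opt) (K : ℕ) :
    ∑ k ∈ Finset.range K, ∫ ω, episodeRegret opt (Mstar ω) (Msamp k ω) ∂P ≤
      (τ * Fintype.card S + Fintype.card (S × A) + τ * (Fintype.card (S × A) * Fintype.card S)) *
        (9 * (τ + 1)) * (√K * (1 + Real.log ((K * τ : ℕ) + 1))) := by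
  have hτ : 0 < τ := Nat.pos_of_ne_zero (NeZero.ne τ)
  set B := 9 * ((τ : ℝ) + 1) * (√K * (1 + Real.log ((K * τ : ℕ) + 1))) with hB
  have hpost := fun k (W : Ω → ℝ × ℝ) => h.identDistrib k W
  have h1 : ∀ x : S, ∑ k ∈ Finset.range K,
      ∫ ω, |(Msamp k ω).initProb x - (Mstar ω).initProb x| ∂P ≤ B := fun x => by
    refine le_trans ?_ ((h.isObservation_init x).integral_sum_abs_sub_le
      (θ := fun M => M.initProb x) hτ (MDP.measurable_initProb x)
      (fun M => ⟨M.initProb_nonneg x, M.initProb_le_one x⟩)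
      h.measurable_Msamp hpost K)
    rw [← sum_range_mul]
    refine Finset.sum_le_sum fun k _ => ?_
    refine le_trans (le_of_eq ?_) (Finset.single_le_sum (fun j _ => integral_nonneg fun ω =>
      mul_nonneg ((h.isObservation_init x).I_nonneg _ ω) (abs_nonneg _)) (Finset.mem_range.2 hτ))
    simp [initObs, Nat.mul_div_cancel k hτ]
  have h2 : ∀ p : S × A, ∑ u ∈ Finset.range (K * τ), ∫ ω, rewardObs s a p.1 p.2 u ω *
      |(Msamp (u / τ) ω).meanReward p.1 p.2 - (Mstar ω).meanReward p.1 p.2| ∂P ≤ B := fun p =>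
    (h.isObservation_reward hτ p.1 p.2).integral_sum_abs_sub_le
      (θ := fun M => M.meanReward p.1 p.2) hτ (MDP.measurable_meanReward p.1 p.2)
      (fun M => ⟨M.meanReward_nonneg _ _, M.meanReward_le_one _ _⟩) h.measurable_Msamp hpost K
  have h3 : ∀ (p : S × A) y, ∑ u ∈ Finset.range (K * τ), ∫ ω, transObs τ s a p.1 p.2 u ω *
      |(Msamp (u / τ) ω).transProb p.1 p.2 y - (Mstar ω).transProb p.1 p.2 y| ∂P ≤ B := fun p y =>
    (h.isObservation_trans hτ p.1 p.2 y).integral_sum_abs_sub_le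
      (θ := fun M => M.transProb p.1 p.2 y) hτ (MDP.measurable_transProb p.1 p.2 y)
      (fun M => ⟨M.transProb_nonneg _ _ _, M.transProb_le_one _ _ _⟩) h.measurable_Msamp hpost K
  have h4 : ∑ u ∈ Finset.range (K * τ), ∫ ω, stepError τ Mstar Msamp s a u ω ∂P ≤
      Fintype.card (S × A) * B + τ * (Fintype.card (S × A) * (Fintype.card S * B)) := by
    simp_rw [h.integral_stepError hτ]
    rw [Finset.sum_add_distrib, ← Finset.mul_sum, Finset.sum_comm]
    gcongr
    · simpa using Finset.sum_le_sum fun p (_ : p ∈ Finset.univ) => h2 p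
    · rw [Finset.sum_comm]
      refine (Finset.sum_le_sum fun p _ => ?_).trans_eq
        (by simp : ∑ _p : S × A, Fintype.card S * B = _)
      rw [Finset.sum_comm]
      simpa using Finset.sum_le_sum fun y (_ : y ∈ Finset.univ) => h3 p y
  calc ∑ k ∈ Finset.range K, ∫ ω, episodeRegret opt (Mstar ω) (Msamp k ω) ∂P
      ≤ ∑ k ∈ Finset.range K,
        (τ * ∑ x, ∫ ω, |(Msamp k ω).initProb x - (Mstar ω).initProb x| ∂P +
        ∑ j ∈ Finset.range τ, ∫ ω, stepError τ Mstar Msamp s a (k * τ + j) ω ∂P) :=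
        Finset.sum_le_sum fun k _ => (h.integral_episodeRegret_le hopt k).2
    _ = τ * ∑ x, ∑ k ∈ Finset.range K,
          ∫ ω, |(Msamp k ω).initProb x - (Mstar ω).initProb x| ∂P +
        ∑ u ∈ Finset.range (K * τ), ∫ ω, stepError τ Mstar Msamp s a u ω ∂P := by
        rw [Finset.sum_add_distrib, ← Finset.mul_sum, Finset.sum_comm, sum_range_mul
          (fun u => ∫ ω, stepError τ Mstar Msamp s a u ω ∂P)]
    _ ≤ τ * (Fintype.card S * B) +
        (Fintype.card (S × A) * B + τ * (Fintype.card (S × A) * (Fintype.card S * B))) := by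
        gcongr
        simpa using Finset.sum_le_sum fun x (_ : x ∈ Finset.univ) => h1 x
    _ = _ := by rw [hB]; ring

end Regret

theorem tendsto_sqrt_mul_log_div_rpow {α : ℝ} (hα : 1 / 2 < α) (c : ℝ) (τ : ℕ) :
    Tendsto (fun T : ℕ => c * (√(T : ℝ) * (1 + Real.log ((T * τ : ℕ) + 1))) / (T : ℝ) ^ α)
      atTop (𝓝 0) := by
  have hβ : 0 < α - 1 / 2 := by linarith
  have h1 : Tendsto (fun x : ℝ => x ^ (-(α - 1 / 2))) atTop (𝓝 0) := tendsto_rpow_neg_atTop hβ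
  have h2 : Tendsto (fun x : ℝ => Real.log x / x ^ (α - 1 / 2)) atTop (𝓝 0) :=
    (isLittleO_log_rpow_atTop hβ).tendsto_div_nhds_zero
  have h3 : Tendsto (fun x : ℝ => (1 + Real.log (τ + 1)) * x ^ (-(α - 1 / 2)) +
      Real.log x / x ^ (α - 1 / 2)) atTop (𝓝 0) := by
    simpa using (h1.const_mul (1 + Real.log (τ + 1))).add h2
  have h4 := h3.comp tendsto_natCast_atTop_atTop
  have h5 : Tendsto (fun T : ℕ => √(T : ℝ) * (1 + Real.log ((T * τ : ℕ) + 1)) / (T : ℝ) ^ α)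
      atTop (𝓝 0) := by
    refine squeeze_zero' (Eventually.of_forall fun T => ?_) ?_ h4
    · have : 0 ≤ Real.log ((T * τ : ℕ) + 1) :=
        Real.log_nonneg (by linarith [(Nat.cast_nonneg (T * τ) : (0 : ℝ) ≤ (T * τ : ℕ))])
      positivity
    · filter_upwards [eventually_ge_atTop 1] with T hT
      have hT1 : (1 : ℝ) ≤ T := by exact_mod_cast hT
      have hT0 : (0 : ℝ) < T := by linarith
      have hl : Real.log ((T * τ : ℕ) + 1) ≤ Real.log (τ + 1) + Real.log T := by
        rw [← Real.log_mul (by positivity) (by positivity)]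
        refine Real.log_le_log (by positivity) ?_
        push_cast
        nlinarith
      have e : √(T : ℝ) / (T : ℝ) ^ α = (T : ℝ) ^ (-(α - 1 / 2)) := by
        rw [Real.sqrt_eq_rpow, ← Real.rpow_sub hT0]
        congr 1
        ring
      simp only [Function.comp_apply]
      rw [div_eq_mul_inv (Real.log _), ← Real.rpow_neg hT0.le, mul_div_right_comm, e]
      have := Real.rpow_nonneg hT0.le (-(α - 1 / 2))
      nlinarith
  simpa [mul_div_assoc] using h5.const_mul c

theorem ceil_div_le (T τ : ℕ) [NeZero τ] : ⌈(T : ℝ) / (τ : ℝ)⌉₊ ≤ T := by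
  refine Nat.ceil_le.2 (div_le_self (Nat.cast_nonneg T) ?_)
  exact_mod_cast Nat.one_le_iff_ne_zero.2 (NeZero.ne τ)

end PSRL

theorem mainTheorem3 {Ω S A : Type*} [MeasurableSpace Ω]
    [Fintype S] [Nonempty S] [MeasurableSpace S] [DiscreteMeasurableSpace S]
    [Fintype A] [Nonempty A] [MeasurableSpace A] [DiscreteMeasurableSpace A]
    (P : Measure Ω) [IsProbabilityMeasure P]
    (τ : ℕ) [NeZero τ]
    (f : Measure (PSRL.MDP S A)) [IsProbabilityMeasure f]
    (opt : PSRL.MDP S A → PSRL.Policy S A τ) (hopt_meas : Measurable opt)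
    (hopt : ∀ M : PSRL.MDP S A, M.IsOptimal (opt M))
    (Mstar : Ω → PSRL.MDP S A) (Msamp : ℕ → Ω → PSRL.MDP S A)
    (s : ℕ → Ω → S) (a : ℕ → Ω → A) (r : ℕ → Ω → unitInterval)
    (hpsrl : PSRL.IsPSRL P τ f opt Mstar Msamp s a r)
    (α : ℝ) (hα : 1 / 2 < α) :
    TendstoInMeasure P (fun (T : ℕ) (ω : Ω) => PSRL.regret opt Mstar Msamp T ω / (T : ℝ) ^ α)
      atTop (fun _ => 0) := by
  set c : ℝ := (τ * Fintype.card S + Fintype.card (S × A) +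
    τ * (Fintype.card (S × A) * Fintype.card S)) * (9 * (τ + 1)) with hc
  have hc0 : 0 ≤ c := by positivity
  have hint := fun k => (hpsrl.integral_episodeRegret_le hopt_meas k).1
  have hrint : ∀ T, Integrable (PSRL.regret opt Mstar Msamp T) P := fun T =>
    integrable_finsetSum _ fun k _ => hint k
  have hr0 : ∀ T ω, 0 ≤ PSRL.regret opt Mstar Msamp T ω := fun T ω =>
    Finset.sum_nonneg fun k _ => PSRL.episodeRegret_nonneg opt hopt _ _
  have hbound : ∀ T : ℕ, ∫ ω, PSRL.regret opt Mstar Msamp T ω ∂P ≤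
      c * (√(T : ℝ) * (1 + Real.log ((T * τ : ℕ) + 1))) := fun T => by
    have hK := PSRL.ceil_div_le T τ
    unfold PSRL.regret
    rw [integral_finsetSum _ fun k _ => hint k]
    refine (hpsrl.integral_sum_episodeRegret_le hopt_meas _).trans ?_
    generalize ⌈(T : ℝ) / (τ : ℝ)⌉₊ = K at hK
    have h1 : 0 ≤ Real.log ((K * τ : ℕ) + 1) :=
      Real.log_nonneg (by linarith [(Nat.cast_nonneg (K * τ) : (0 : ℝ) ≤ (K * τ : ℕ))])
    have h2 : ((K * τ : ℕ) : ℝ) + 1 ≤ (T * τ : ℕ) + 1 := by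
      exact_mod_cast Nat.add_le_add_right (Nat.mul_le_mul_right τ hK) 1
    have h3 : √(K : ℝ) ≤ √(T : ℝ) := Real.sqrt_le_sqrt (by exact_mod_cast hK)
    rw [← hc]
    gcongr
  rw [tendstoInMeasure_iff_measureReal_norm]
  intro ε hε
  have hlim := (PSRL.tendsto_sqrt_mul_log_div_rpow hα c τ).div_const ε
  rw [zero_div] at hlim
  refine squeeze_zero (fun T => measureReal_nonneg) (fun T => ?_) hlim
  have hT : 0 ≤ (T : ℝ) ^ α := Real.rpow_nonneg (Nat.cast_nonneg T) α
  have hq0 : ∀ ω, 0 ≤ PSRL.regret opt Mstar Msamp T ω / (T : ℝ) ^ α := fun ω =>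
    div_nonneg (hr0 T ω) hT
  have hm := mul_meas_ge_le_integral_of_nonneg (μ := P) (ae_of_all _ hq0)
    ((hrint T).div_const _) ε
  rw [integral_div] at hm
  simp only [sub_zero, Real.norm_of_nonneg (hq0 _)]
  rw [le_div_iff₀ hε, mul_comm]
  exact hm.trans (div_le_div_of_nonneg_right (hbound T) hT)
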